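/- Let $M$ be a smooth (Hausdorff, paracompact) manifold of dimension $n\ge 3$, let $T^\circ M$ be its tangent bundle with the zero section removed, with projection $\tau$, induced coordinates $(x^i,y^i)$ and Liouville field $\Delta=y^i\,\partial/\partial y^i$, and write $V_i=\partial/\partial y^i$. Let $\Gamma$ be a spray on $T^\circ M$, i.e. a smooth vector field with $\tau_*\Gamma_v=v$ and $[\Delta,\Gamma]=\Gamma$; locally $\Gamma=y^i\,\partial/\partial x^i-2\Gamma^i\,\partial/\partial y^i$. Its geodesics are the projections to $M$ of its integral curves, and its projective class consists of all sprays that have the same geodesics up to orientation-preserving reparametrization. Put $\Gamma^j_i=V_i(\Gamma^j)$, $H_i=\partial/\partial x^i-\Gamma_i^jV_j$, and let $J=V_i\otimes dx^i$ be the tangent structure and $H=H_i\otimes dx^i$ the horizontal projector; for a type $(1,1)$ tensor field $K$ let $d_K=i_K\circ d-d\circ i_K$ on 1-forms. A bilinear form $h_{ij}$ on $T_{\tau(y)}M$, depending on $y\in T^\circ M$, is quasi-regular at $y$ if $h_{ij}v^j=0$ holds exactly when $v$ is a scalar multiple of $y$. A pseudo-Finsler function is a smooth function $F$ on $T^\circ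 M$ that is positively homogeneous of degree one in $y$ and whose fibre Hessian $\partial^2F/\partial y^i\partial y^j$ is quasi-regular at every point; its geodesic class is the set of sprays all of whose geodesics satisfy the Euler--Lagrange equations $\frac{d}{dt}\frac{\partial F}{\partial y^i}=\frac{\partial F}{\partial x^i}$ of $F$. (1) The projective class of sprays containing $\Gamma$ is the geodesic class of some pseudo-Finsler function on $T^\circ M$ if and only if there is a smooth semi-basic 1-form $\theta$ on $T^\circ M$ such that $$\mathcal L_\Delta\theta=0,\qquad d_J\theta=0,\qquad d_H\theta=0,$$ and $\operatorname{rk}(d\theta)=2n-2$ everywhere on $T^\circ M$. (2) For every smooth semi-basic 1-form $\theta=\theta_i\,dx^i$ on $T^\circ M$ with $\mathcal L_\Delta\theta=0$, $d_J\theta=0$ and $d_H\theta=0$, and at every point of $T^\circ M$, one has $\operatorname{rk}(d\theta)=2n-2$ if and only if $h_{ij}=V_i(\theta_j)$ is quasi-regular. -/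

import Mathlib

open scoped Manifold ContDiff

noncomputable section

namespace SprayGeometry

/-- The coordinate space `ℝⁿ`. -/
abbrev Coord (n : ℕ) : Type := EuclideanSpace ℝ (Fin n)

/-! ### Calculus on a coordinate domain of the tangent bundle

A point of the coordinate space `ℝⁿ × ℝⁿ` is written `z = (x, y)`, with `x` the base coordinates and
`y` the fibre coordinates. A 1-form is a map into `ℝⁿ × ℝⁿ →L[ℝ] ℝ`. -/

section Calculus

variable {W : Type*} [NormedAddCommGroup W] [NormedSpace ℝ W]

/-- Exterior derivative of a 1-form on a normed space: `dα(u, w) = (D_u α)(w) - (D_w α)(u)`. -/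
def dForm (α : W → W →L[ℝ] ℝ) (z : W) : W →L[ℝ] W →L[ℝ] ℝ :=
  fderiv ℝ α z - (fderiv ℝ α z).flip

/-- `dForm` is Mathlib's exterior derivative in degree one. -/
theorem extDeriv_eq_dForm (α : W → W →L[ℝ] ℝ) (z : W) (hα : DifferentiableAt ℝ α z) (u w : W) :
    extDeriv (fun p => ContinuousAlternatingMap.ofSubsingleton ℝ W ℝ (0 : Fin 1) (α p)) z ![u, w] =
      dForm α z u w := by
  let L := (ContinuousAlternatingMap.ofSubsingletonLIE (𝕜 := ℝ) (E := W) (F := ℝ) (0 : Fin 1)).toContinuousLinearEquiv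
  have h : HasFDerivAt (fun p => ContinuousAlternatingMap.ofSubsingleton ℝ W ℝ (0 : Fin 1) (α p))
      ((L : (W →L[ℝ] ℝ) →L[ℝ] _).comp (fderiv ℝ α z)) z :=
    L.hasFDerivAt.comp z hα.hasFDerivAt
  rw [extDeriv, h.fderiv, ContinuousAlternatingMap.alternatizeUncurryFin_apply, Fin.sum_univ_two]
  simp [dForm, L, sub_eq_add_neg]
  rfl

/-- Lie derivative of the 1-form `α` along the vector field `X`. -/
def lieDerivForm (X : W → W) (α : W → W →L[ℝ] ℝ) (z : W) : W →L[ℝ] ℝ :=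
  fderiv ℝ α z (X z) + (α z).comp (fderiv ℝ X z)

/-- The operator `d_K = i_K ∘ d - d ∘ i_K` of a type `(1,1)` tensor field `K`, on 1-forms:
`(d_K α)(u, w) = dα(K u, w) + dα(u, K w) - d(α ∘ K)(u, w)`. -/
def dAlong (K : W → W →L[ℝ] W) (α : W → W →L[ℝ] ℝ) (z u w : W) : ℝ :=
  dForm α z (K z u) w + dForm α z u (K z w) - dForm (fun p => (α p).comp (K p)) z u w

/-- The rank of a bilinear form, in particular of a 2-form at a point. -/
def formRank (B : W →L[ℝ] W →L[ℝ] ℝ) : ℕ :=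
  Module.finrank ℝ (LinearMap.range (B : W →ₗ[ℝ] W →L[ℝ] ℝ))

variable {n : ℕ}

/-- The derivatives `V_i f = ∂f/∂yⁱ` with respect to the fibre coordinates. -/
def vertDeriv (f : Coord n × Coord n → W) (z : Coord n × Coord n) : Coord n →L[ℝ] W :=
  (fderiv ℝ f z).comp (ContinuousLinearMap.inr ℝ (Coord n) (Coord n))

/-- The derivatives `∂f/∂xⁱ` with respect to the base coordinates. -/
def baseDeriv (f : Coord n × Coord n → W) (z : Coord n × Coord n) : Coord n →L[ℝ] W :=
  (fderiv ℝ f z).comp (ContinuousLinearMap.inl ℝ (Coord n) (Coord n))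

/-- The Liouville field `yⁱ ∂/∂yⁱ` in coordinates. -/
def liouvilleCoord (z : Coord n × Coord n) : Coord n × Coord n := (0, z.2)

/-- The tangent structure `J = ∂/∂yⁱ ⊗ dxⁱ` in coordinates. -/
def tangentStructure (_z : Coord n × Coord n) :
    (Coord n × Coord n) →L[ℝ] (Coord n × Coord n) :=
  (ContinuousLinearMap.inr ℝ (Coord n) (Coord n)).comp
    (ContinuousLinearMap.fst ℝ (Coord n) (Coord n))

/-- The coefficients `Γⁱ` of a vector field `yⁱ ∂/∂xⁱ - 2 Γⁱ ∂/∂yⁱ`. -/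
def sprayCoeff (X : Coord n × Coord n → Coord n × Coord n) (z : Coord n × Coord n) : Coord n :=
  (-(1 / 2 : ℝ)) • (X z).2

/-- The horizontal projector `H = H_i ⊗ dxⁱ`, with `H_i = ∂/∂xⁱ - Γ_i^j ∂/∂y^j` and
`Γ_i^j = ∂Γ^j/∂yⁱ`, of a vector field `X = yⁱ ∂/∂xⁱ - 2 Γⁱ ∂/∂yⁱ`, in coordinates. -/
def horizontalProjector (X : Coord n × Coord n → Coord n × Coord n) (z : Coord n × Coord n) :
    (Coord n × Coord n) →L[ℝ] (Coord n × Coord n) :=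
  ((ContinuousLinearMap.id ℝ (Coord n)).prod (-vertDeriv (sprayCoeff X) z)).comp
    (ContinuousLinearMap.fst ℝ (Coord n) (Coord n))

/-- The bilinear form `h` is quasi-regular at `y`: `h_{ij} v^j = 0` if and only if `v` is a scalar
multiple of `y`. -/
def QuasiRegular (h : Coord n →L[ℝ] Coord n →L[ℝ] ℝ) (y : Coord n) : Prop :=
  ∀ v : Coord n, (∀ u : Coord n, h u v = 0) ↔ ∃ k : ℝ, v = k • y

end Calculus

section Manifold

variable {n : ℕ} {M : Type*} [TopologicalSpace M] [ChartedSpace (Coord n) M]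
  [IsManifold (𝓡 n) ∞ M]

/-- The slit tangent bundle `T°M`: the nonzero tangent vectors of `M`. Geometric objects on `T°M` are
given as objects on `TM` of which only the values on this open set are used. -/
def slit (n : ℕ) (M : Type*) [TopologicalSpace M] [ChartedSpace (Coord n) M]
    [IsManifold (𝓡 n) ∞ M] : Set (TangentBundle (𝓡 n) M) :=
  {v | v.snd ≠ 0}

/-- A (not necessarily smooth) vector field on `TM`. -/
abbrev Field (n : ℕ) (M : Type*) [TopologicalSpace M] [ChartedSpace (Coord n) M]
    [IsManifold (𝓡 n) ∞ M] : Type _ :=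
  (v : TangentBundle (𝓡 n) M) → TangentSpace (𝓡 n).tangent v

/-- A (not necessarily smooth) 1-form on `TM`. -/
abbrev OneForm (n : ℕ) (M : Type*) [TopologicalSpace M] [ChartedSpace (Coord n) M]
    [IsManifold (𝓡 n) ∞ M] : Type _ :=
  (v : TangentBundle (𝓡 n) M) → (TangentSpace (𝓡 n).tangent v →L[ℝ] ℝ)

/-- The chart `(xⁱ, yⁱ)` of `TM` induced by the chart `(xⁱ)` of `M` around `c`. -/
def tangentChart (c : M) : PartialEquiv (TangentBundle (𝓡 n) M) (Coord n × Coord n) :=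
  extChartAt (𝓡 n).tangent (⟨c, 0⟩ : TangentBundle (𝓡 n) M)

/-- The part of the image of `tangentChart c` that corresponds to nonzero vectors. -/
def chartDomain (c : M) : Set (Coord n × Coord n) :=
  (tangentChart c).target ∩ (tangentChart c).symm ⁻¹' slit n M

/-- A function on `TM` in the coordinates `tangentChart c`. -/
def funCoord (F : TangentBundle (𝓡 n) M → ℝ) (c : M) (z : Coord n × Coord n) : ℝ :=
  F ((tangentChart c).symm z)

/-- A vector field on `TM` in the coordinates `tangentChart c`. -/
def fieldCoord (X : Field n M) (c : M) (z : Coord n × Coord n) : Coord n × Coord n :=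
  VectorField.mpullback 𝓘(ℝ, Coord n × Coord n) (𝓡 n).tangent (tangentChart c).symm X z

/-- A 1-form on `TM` in the coordinates `tangentChart c`. -/
def formCoord (α : OneForm n M) (c : M) (z : Coord n × Coord n) : (Coord n × Coord n) →L[ℝ] ℝ :=
  (α ((tangentChart c).symm z)).comp
    (mfderiv 𝓘(ℝ, Coord n × Coord n) (𝓡 n).tangent (tangentChart c).symm z)

/-! ### Sprays, geodesics and projective classes -/

/-- The Liouville field: its value at `v` is the velocity of the curve `t ↦ t v` at `t = 1`. -/
def liouville : Field n M := fun v =>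
  mfderiv 𝓘(ℝ, ℝ) (𝓡 n).tangent
    (fun t : ℝ => (⟨v.proj, t • v.snd⟩ : TangentBundle (𝓡 n) M)) 1 (1 : ℝ)

/-- `Γ` is a spray: a smooth vector field on `T°M` with `τ_* Γ_v = v` and `[Δ, Γ] = Γ`. -/
structure IsSpray (Γ : Field n M) : Prop where
  smooth : ContMDiffOn (𝓡 n).tangent (𝓡 n).tangent.tangent ∞
    (fun v => (⟨v, Γ v⟩ : TangentBundle (𝓡 n).tangent (TangentBundle (𝓡 n) M))) (slit n M)
  secondOrder : ∀ v ∈ slit n M,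
    mfderiv (𝓡 n).tangent (𝓡 n)
      (Bundle.TotalSpace.proj : TangentBundle (𝓡 n) M → M) v (Γ v) = v.snd
  homogeneous : ∀ v ∈ slit n M,
    VectorField.mlieBracket (𝓡 n).tangent (liouville : Field n M) Γ v = Γ v

/-- `s` is an open interval (possibly unbounded, possibly empty). -/
def IsOpenInterval (s : Set ℝ) : Prop := IsOpen s ∧ s.OrdConnected

/-- On the open interval `s` the curve `σ` in `M` is a geodesic of `Γ`, that is, the projection of an
integral curve of `Γ` in `T°M`. -/
def IsGeodesicOn (Γ : Field n M) (σ : ℝ → M) (s : Set ℝ) : Prop :=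
  IsOpenInterval s ∧ ∃ c : ℝ → TangentBundle (𝓡 n) M,
    IsMIntegralCurveOn c Γ s ∧ ∀ t ∈ s, c t ∈ slit n M ∧ (c t).proj = σ t

/-- Every geodesic of `Γ` is a geodesic of `Γ'` after an orientation-preserving reparametrization
`φ`, a bijection between open intervals with positive derivative. -/
def GeodesicsReparametrize (Γ Γ' : Field n M) : Prop :=
  ∀ (σ : ℝ → M) (s : Set ℝ), IsGeodesicOn Γ σ s →
    ∃ (φ : ℝ → ℝ) (s' : Set ℝ), Set.BijOn φ s' s ∧
      (∀ r ∈ s', ∃ a : ℝ, 0 < a ∧ HasDerivAt φ a r) ∧ IsGeodesicOn Γ' (σ ∘ φ) s'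

/-- Projective equivalence: the same geodesics up to orientation-preserving reparametrization. -/
def ProjectivelyEquivalent (Γ Γ' : Field n M) : Prop :=
  GeodesicsReparametrize Γ Γ' ∧ GeodesicsReparametrize Γ' Γ

/-- The projective class of sprays containing `Γ`. -/
def projectiveClass (Γ : Field n M) : Set (Field n M) :=
  {Γ' | IsSpray Γ' ∧ ProjectivelyEquivalent Γ Γ'}

/-! ### Pseudo-Finsler functions and their geodesic classes -/

/-- The components `∂²F/∂yⁱ∂yʲ` of the fibre Hessian of `F` in the coordinates `tangentChart c`. -/
def hessian (F : TangentBundle (𝓡 n) M → ℝ) (c : M) (z : Coord n × Coord n) :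
    Coord n →L[ℝ] Coord n →L[ℝ] ℝ :=
  vertDeriv (vertDeriv (funCoord F c)) z

/-- `F` is a pseudo-Finsler function: smooth on `T°M`, positively homogeneous (of degree one), with
quasi-regular fibre Hessian. -/
structure IsPseudoFinsler (F : TangentBundle (𝓡 n) M → ℝ) : Prop where
  smooth : ContMDiffOn (𝓡 n).tangent 𝓘(ℝ, ℝ) ∞ F (slit n M)
  homogeneous : ∀ v ∈ slit n M, ∀ a : ℝ, 0 < a → F ⟨v.proj, a • v.snd⟩ = a * F v
  quasiRegular : ∀ c : M, ∀ z ∈ chartDomain (n := n) c, QuasiRegular (hessian F c z) z.2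

/-- The curve `σ` solves on `s` the Euler-Lagrange equations
`d/dt (∂F/∂yⁱ(σ, σ')) = ∂F/∂xⁱ(σ, σ')`, written in all the coordinates of `M` that contain the
point under consideration. -/
def SolvesEulerLagrange (F : TangentBundle (𝓡 n) M → ℝ) (σ : ℝ → M) (s : Set ℝ) : Prop :=
  ∀ c : M, ∀ t ∈ s, σ t ∈ (extChartAt (𝓡 n) c).source →
    let x : ℝ → Coord n := fun r => extChartAt (𝓡 n) c (σ r)
    HasDerivAt (fun r => vertDeriv (funCoord F c) (x r, deriv x r))
      (baseDeriv (funCoord F c) (x t, deriv x t)) t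

/-- The geodesic class of `F`: the sprays whose geodesics solve the Euler-Lagrange equations
of `F`. -/
def geodesicClass (F : TangentBundle (𝓡 n) M → ℝ) : Set (Field n M) :=
  {Γ | IsSpray Γ ∧ ∀ (σ : ℝ → M) (s : Set ℝ), IsGeodesicOn Γ σ s → SolvesEulerLagrange F σ s}

/-! ### Semi-basic 1-forms -/

/-- `θ` is a smooth 1-form on `T°M`. -/
def IsSmoothForm (θ : OneForm n M) : Prop :=
  ∀ c : M, ContDiffOn ℝ ∞ (formCoord θ c) (chartDomain c)

/-- `θ` is semi-basic: it vanishes on the vertical vectors of `T°M`. -/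
def IsSemiBasic (θ : OneForm n M) : Prop :=
  ∀ v ∈ slit n M, ∀ ξ : TangentSpace (𝓡 n).tangent v,
    mfderiv (𝓡 n).tangent (𝓡 n)
      (Bundle.TotalSpace.proj : TangentBundle (𝓡 n) M → M) v ξ = 0 → θ v ξ = 0

/-- The differential conditions `L_Δ θ = 0`, `d_J θ = 0` and `d_H θ = 0` on `T°M`, where `H` is the
horizontal projector of `Γ`. -/
structure DifferentialConditions (Γ : Field n M) (θ : OneForm n M) : Prop where
  lie : ∀ c : M, ∀ z ∈ chartDomain (n := n) c, lieDerivForm liouvilleCoord (formCoord θ c) z = 0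
  dJ : ∀ c : M, ∀ z ∈ chartDomain (n := n) c, ∀ u w,
    dAlong tangentStructure (formCoord θ c) z u w = 0
  dH : ∀ c : M, ∀ z ∈ chartDomain (n := n) c, ∀ u w,
    dAlong (horizontalProjector (fieldCoord Γ c)) (formCoord θ c) z u w = 0

/-- The 2-form `dθ` has rank `r` at `v`. -/
def HasRankAt (θ : OneForm n M) (v : TangentBundle (𝓡 n) M) (r : ℕ) : Prop :=
  ∀ c : M, v ∈ (tangentChart c).source → formRank (dForm (formCoord θ c) (tangentChart c v)) = r

/-- The multiplier `h_{ij} = V_i(θ_j)` of the semi-basic 1-form `θ = θ_j dx^j`. -/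
def multiplier (θ : OneForm n M) (c : M) (z : Coord n × Coord n) :
    Coord n →L[ℝ] Coord n →L[ℝ] ℝ :=
  vertDeriv (fun p => (formCoord θ c p).comp (ContinuousLinearMap.inl ℝ (Coord n) (Coord n))) z

/-- The multiplier `h_{ij} = V_i(θ_j)` is quasi-regular at `v`. -/
def MultiplierQuasiRegularAt (θ : OneForm n M) (v : TangentBundle (𝓡 n) M) : Prop :=
  ∀ c : M, v ∈ (tangentChart c).source →
    QuasiRegular (multiplier θ c (tangentChart c v)) (tangentChart c v).2

end Manifold

end SprayGeometry

end

/-!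
In the coordinates `z = (x, y)` of a chart of `TM` a semi-basic form is `θ = β_i dxⁱ`, and
everything is a statement about the map `β` and its derivative. The conditions `L_Δ θ = 0`,
`d_J θ = 0` and `d_H θ = 0` say that `β` is homogeneous of degree zero in `y`, that `h_{ij} = V_i β_j` is
symmetric and that `H_i β_j` is symmetric (`differentialConditions_iff`).

In the frame `(V_i, H_i)` the 2-form `dθ` then has the block matrix `[0, h; -h, 0]`, so its kernel
is isomorphic to `ker h × ker h` (`finrank_range_add_two_mul_finrank_ker`). As `y` is in `ker h`,
the rank is `2n - 2` exactly if `ker h` is the line spanned by `y`, which is the second assertion.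

For the first one, `F` and `θ` determine each other by `θ = d_J F` and `F = θ(Γ)`, with the
multiplier of `θ` equal to the Hessian of `F`. All geodesics of a spray `Γ` solve the
Euler-Lagrange equations of `F` exactly if `Γ (∂F/∂yⁱ) = ∂F/∂xⁱ` on `T°M`, since there is a
geodesic through every point (`mem_geodesicClass_iff`). Differentiating this identity in the fibre
directions and taking the skew part gives `d_H d_J F = 0`
(`fderiv_vertDeriv_horizontalProjector_symm`). Conversely `d_H θ = 0` contracted with `Γ = yⁱ H_i`
is the identity for `F = θ(Γ)` (`isPseudoFinsler_contraction`).

It remains that the geodesic class of `F` is the projective class of any of its members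
(`IsPseudoFinsler.geodesicClass_eq_projectiveClass`). Two members differ by a section of the
kernel of the Hessian, that is, by a multiple `P Δ` of the Liouville field, and then their
geodesics correspond under the solutions of `φ'' = P φ'²`, which are found by two quadratures
(`IsSpray.geodesicsReparametrize`). In the other direction the Euler-Lagrange equations are
invariant under reparametrization because of the homogeneity of `F`
(`IsPseudoFinsler.eulerLagrangeAt_of_reparametrize`).
-/

noncomputable section

namespace SprayGeometry

open scoped Topology
open Set Filter

/-! ### Semi-basic forms in coordinates -/

section SemiBasicCalculus

variable {n : ℕ} {α : Coord n × Coord n → (Coord n × Coord n) →L[ℝ] ℝ}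
  {β : Coord n × Coord n → Coord n →L[ℝ] ℝ} {z : Coord n × Coord n}

theorem hasFDerivAt_semiBasic
    (hα : ∀ᶠ p in 𝓝 z, α p = (β p).comp (ContinuousLinearMap.fst ℝ (Coord n) (Coord n)))
    (hβ : DifferentiableAt ℝ β z) :
    HasFDerivAt α (((ContinuousLinearMap.compL ℝ (Coord n × Coord n) (Coord n) ℝ).flip
      (ContinuousLinearMap.fst ℝ (Coord n) (Coord n))).comp (fderiv ℝ β z)) z :=
  (((ContinuousLinearMap.compL ℝ (Coord n × Coord n) (Coord n) ℝ).flip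
      (ContinuousLinearMap.fst ℝ (Coord n) (Coord n))).hasFDerivAt.comp z
      hβ.hasFDerivAt).congr_of_eventuallyEq hα

theorem dForm_semiBasic
    (hα : ∀ᶠ p in 𝓝 z, α p = (β p).comp (ContinuousLinearMap.fst ℝ (Coord n) (Coord n)))
    (hβ : DifferentiableAt ℝ β z) (u w : Coord n × Coord n) :
    dForm α z u w = fderiv ℝ β z u w.1 - fderiv ℝ β z w u.1 := by
  simp [dForm, (hasFDerivAt_semiBasic hα hβ).fderiv]

theorem dAlong_tangentStructure_semiBasic
    (hα : ∀ᶠ p in 𝓝 z, α p = (β p).comp (ContinuousLinearMap.fst ℝ (Coord n) (Coord n)))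
    (hβ : DifferentiableAt ℝ β z) (u w : Coord n × Coord n) :
    dAlong tangentStructure α z u w = vertDeriv β z u.1 w.1 - vertDeriv β z w.1 u.1 := by
  have h0 : (fun p => (α p).comp (tangentStructure p)) =ᶠ[𝓝 z] fun _ => 0 := by
    filter_upwards [hα] with p hp
    ext u <;> simp [hp, tangentStructure]
  have h1 : dForm (fun p => (α p).comp (tangentStructure p)) z u w = 0 := by
    have h2 : fderiv ℝ (fun p => (α p).comp (tangentStructure p)) z = 0 :=
      h0.fderiv_eq.trans (hasFDerivAt_const _ z).fderiv
    rw [dForm, h2]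
    simp
  rw [dAlong, dForm_semiBasic hα hβ, dForm_semiBasic hα hβ, h1]
  simp [tangentStructure, vertDeriv, sub_eq_add_neg]

theorem dAlong_horizontalProjector_semiBasic {X : Coord n × Coord n → Coord n × Coord n}
    (hα : ∀ᶠ p in 𝓝 z, α p = (β p).comp (ContinuousLinearMap.fst ℝ (Coord n) (Coord n)))
    (hβ : DifferentiableAt ℝ β z) (u w : Coord n × Coord n) :
    dAlong (horizontalProjector X) α z u w =
      fderiv ℝ β z (horizontalProjector X z u) w.1 -
        fderiv ℝ β z (horizontalProjector X z w) u.1 := by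
  have h0 : ∀ᶠ p in 𝓝 z, (α p).comp (horizontalProjector X p) =
      (β p).comp (ContinuousLinearMap.fst ℝ (Coord n) (Coord n)) := by
    filter_upwards [hα] with p hp
    ext u <;> simp [hp, horizontalProjector]
  rw [dAlong, dForm_semiBasic hα hβ, dForm_semiBasic hα hβ, dForm_semiBasic h0 hβ]
  simp only [horizontalProjector, ContinuousLinearMap.comp_apply, ContinuousLinearMap.prod_apply,
    ContinuousLinearMap.id_apply, ContinuousLinearMap.coe_fst']
  ring

theorem hasFDerivAt_liouvilleCoord (z : Coord n × Coord n) :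
    HasFDerivAt liouvilleCoord
      ((0 : (Coord n × Coord n) →L[ℝ] Coord n).prod (ContinuousLinearMap.snd ℝ _ _)) z :=
  (hasFDerivAt_const (0 : Coord n) z).prodMk hasFDerivAt_snd

theorem lieDerivForm_liouvilleCoord_semiBasic
    (hα : ∀ᶠ p in 𝓝 z, α p = (β p).comp (ContinuousLinearMap.fst ℝ (Coord n) (Coord n)))
    (hβ : DifferentiableAt ℝ β z) :
    lieDerivForm liouvilleCoord α z =
      (vertDeriv β z z.2).comp (ContinuousLinearMap.fst ℝ (Coord n) (Coord n)) := by
  refine ContinuousLinearMap.ext fun w => ?_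
  rw [lieDerivForm, (hasFDerivAt_semiBasic hα hβ).fderiv, (hasFDerivAt_liouvilleCoord z).fderiv,
    hα.self_of_nhds]
  simp [liouvilleCoord, vertDeriv]

end SemiBasicCalculus

/-! ### The rank of the exterior derivative -/

section Rank

variable {E : Type*} [NormedAddCommGroup E] [NormedSpace ℝ E] [FiniteDimensional ℝ E]

/-- With respect to a horizontal complement `w ↦ (w, -N w)` of the vertical space the 2-form
`(u, w) ↦ D u w.1 - D w u.1` has the block matrix `[0, -h; h, 0]` with `h u w = D (0, u) w`, so that
its kernel is isomorphic to `ker h × ker h`. -/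
theorem finrank_range_add_two_mul_finrank_ker {B : (E × E) →L[ℝ] (E × E) →L[ℝ] ℝ}
    {D : (E × E) →L[ℝ] E →L[ℝ] ℝ} {N : E →L[ℝ] E}
    (hB : ∀ u w, B u w = D u w.1 - D w u.1)
    (hsymm : ∀ u w, D (0, u) w = D (0, w) u)
    (hN : ∀ u w, D (u, -N u) w = D (w, -N w) u) :
    Module.finrank ℝ (LinearMap.range (B : (E × E) →ₗ[ℝ] (E × E) →L[ℝ] ℝ)) +
      2 * Module.finrank ℝ (LinearMap.ker
        (D.comp (ContinuousLinearMap.inr ℝ E E) : E →ₗ[ℝ] E →L[ℝ] ℝ)) =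
      2 * Module.finrank ℝ E := by
  set K := LinearMap.ker (D.comp (ContinuousLinearMap.inr ℝ E E) : E →ₗ[ℝ] E →L[ℝ] ℝ)
  have hmemK : ∀ v, v ∈ K ↔ ∀ w, D (0, v) w = 0 := by
    intro v
    rw [LinearMap.mem_ker]
    exact ⟨fun h w => congrArg (fun L : E →L[ℝ] ℝ => L w) h, fun h => ContinuousLinearMap.ext h⟩
  have hsplit : ∀ u w, B u w = D (0, u.2 + N u.1) w.1 - D (0, w.2 + N w.1) u.1 := by
    intro u w
    have e : ∀ u : E × E, D u = D (u.1, -N u.1) + D (0, u.2 + N u.1) := by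
      intro u; rw [← map_add]; simp
    rw [hB, e u, e w]
    have := hN u.1 w.1
    simp only [add_apply]
    linarith
  have hker : ∀ u : E × E, u ∈ LinearMap.ker (B : (E × E) →ₗ[ℝ] (E × E) →L[ℝ] ℝ) ↔
      u.1 ∈ K ∧ u.2 + N u.1 ∈ K := by
    intro u
    rw [LinearMap.mem_ker, hmemK, hmemK]
    constructor
    · intro h
      have h' : ∀ w, B u w = 0 := fun w => congrArg (fun L : (E × E) →L[ℝ] ℝ => L w) h
      constructor
      · intro w
        have := h' (0, w)
        rw [hsplit] at this
        rw [hsymm]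
        simpa using this
      · intro w
        have := h' (w, -N w)
        rw [hsplit] at this
        simpa [show ((0 : E), (0 : E)) = 0 from rfl] using this
    · rintro ⟨h1, h2⟩
      refine ContinuousLinearMap.ext fun w => ?_
      refine (hsplit u w).trans ?_
      rw [h2, hsymm, h1]
      simp
  let Φ : LinearMap.ker (B : (E × E) →ₗ[ℝ] (E × E) →L[ℝ] ℝ) ≃ₗ[ℝ] K × K :=
    { toFun := fun u => (⟨u.1.1, ((hker _).1 u.2).1⟩, ⟨u.1.2 + N u.1.1, ((hker _).1 u.2).2⟩)
      invFun := fun k => ⟨(k.1, k.2 - N k.1), (hker _).2 (by simp)⟩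
      map_add' := fun u w => by
        ext <;> simp
        abel
      map_smul' := fun a u => by ext <;> simp
      left_inv := fun u => by ext <;> simp
      right_inv := fun k => by ext <;> simp }
  have h1 := LinearMap.finrank_range_add_finrank_ker (B : (E × E) →ₗ[ℝ] (E × E) →L[ℝ] ℝ)
  rw [Φ.finrank_eq, Module.finrank_prod, Module.finrank_prod] at h1
  linarith

/-- A symmetric form with `y ≠ 0` in its kernel is quasi-regular at `y` exactly when its kernel is a
line. -/
theorem quasiRegular_iff_finrank_ker {n : ℕ} {h : Coord n →L[ℝ] Coord n →L[ℝ] ℝ} {y : Coord n}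
    (hsymm : ∀ u w, h u w = h w u) (hy : y ≠ 0) (hhy : h y = 0) :
    QuasiRegular h y ↔
      Module.finrank ℝ (LinearMap.ker (h : Coord n →ₗ[ℝ] Coord n →L[ℝ] ℝ)) = 1 := by
  set K := LinearMap.ker (h : Coord n →ₗ[ℝ] Coord n →L[ℝ] ℝ)
  have hmemK : ∀ v, v ∈ K ↔ ∀ u, h u v = 0 := by
    intro v
    rw [LinearMap.mem_ker]
    exact ⟨fun hv u => (hsymm u v).trans (congrArg (fun L : Coord n →L[ℝ] ℝ => L u) hv),
      fun hv => ContinuousLinearMap.ext fun u => (hsymm v u).trans (hv u)⟩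
  have hyK : y ∈ K := hhy
  rw [finrank_eq_one_iff_of_nonzero' (⟨y, hyK⟩ : K) (by simpa [Subtype.ext_iff] using hy)]
  constructor
  · rintro hq ⟨v, hv⟩
    obtain ⟨k, hk⟩ := (hq v).1 ((hmemK v).1 hv)
    exact ⟨k, Subtype.ext hk.symm⟩
  · intro hq v
    rw [← hmemK]
    constructor
    · intro hv
      obtain ⟨k, hk⟩ := hq ⟨v, hv⟩
      exact ⟨k, (congrArg Subtype.val hk).symm⟩
    · rintro ⟨k, rfl⟩
      exact K.smul_mem k hyK

end Rank

/-! ### Homogeneous functions -/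

section Homogeneous

variable {n : ℕ} {W : Type*} [NormedAddCommGroup W] [NormedSpace ℝ W]

/-- Integration of Euler's identity along a ray in a fibre. -/
theorem apply_smul_of_euler {g : Coord n × Coord n → W} {x y : Coord n} (m : ℕ)
    (hg : ∀ a : ℝ, 0 < a → DifferentiableAt ℝ g (x, a • y))
    (heuler : ∀ a : ℝ, 0 < a → vertDeriv g (x, a • y) (a • y) = (m : ℝ) • g (x, a • y))
    {a : ℝ} (ha : 0 < a) : g (x, a • y) = a ^ m • g (x, y) := by
  have hderiv : ∀ t : ℝ, 0 < t →
      HasDerivAt (fun t : ℝ => (t ^ m)⁻¹ • g (x, t • y)) 0 t := by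
    intro t ht
    have h1 : HasDerivAt (fun t : ℝ => (x, t • y)) (0, y) t := by
      simpa using (hasDerivAt_const t x).prodMk ((hasDerivAt_id t).smul_const y)
    have h2 : HasDerivAt (fun t : ℝ => g (x, t • y)) (fderiv ℝ g (x, t • y) (0, y)) t :=
      (hg t ht).hasFDerivAt.comp_hasDerivAt t h1
    have h3 := ((hasDerivAt_pow m t).inv (pow_pos ht m).ne').smul h2
    convert! h3 using 1
    have h4 : fderiv ℝ g (x, t • y) (0, y) = t⁻¹ • (m : ℝ) • g (x, t • y) := by
      rw [← heuler t ht, vertDeriv, ContinuousLinearMap.comp_apply, ContinuousLinearMap.inr_apply,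
        ← map_smul]
      congr 1
      simp [smul_smul, inv_mul_cancel₀ ht.ne']
    rw [h4, smul_smul, smul_smul, ← add_smul]
    refine (zero_smul ℝ (g (x, t • y))).symm.trans ?_
    congr 1
    rcases m with _ | m
    · simp
    · have := ht.ne'
      simp only [Nat.add_sub_cancel, Pi.inv_apply]
      field_simp
      ring
  -- by Euler's identity `t⁻ᵐ g(x, t y)` is constant in `t > 0`
  have hconst := (convex_Ioi (0 : ℝ)).is_const_of_fderivWithin_eq_zero (𝕜 := ℝ)
    (f := fun t : ℝ => (t ^ m)⁻¹ • g (x, t • y))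
    (fun t ht => (hderiv t ht).differentiableAt.differentiableWithinAt)
    (fun t ht => by
      rw [fderivWithin_of_isOpen isOpen_Ioi ht]
      simpa using (hderiv t ht).hasFDerivAt.fderiv)
    (mem_Ioi.2 ha) (mem_Ioi.2 one_pos)
  simp only [one_pow, inv_one, one_smul] at hconst
  rw [← hconst, smul_smul, mul_inv_cancel₀ (pow_pos ha m).ne', one_smul]

/-- Euler's identity for a function that is positively homogeneous of degree one along the rays. -/
theorem vertDeriv_self_of_homogeneous {f : Coord n × Coord n → ℝ} {z : Coord n × Coord n}
    (hf : DifferentiableAt ℝ f z) (hhom : ∀ a : ℝ, 0 < a → f (z.1, a • z.2) = a * f z) :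
    vertDeriv f z z.2 = f z := by
  have h1 : HasDerivAt (fun t : ℝ => (z.1, t • z.2)) (0, z.2) 1 := by
    simpa using (hasDerivAt_const (1 : ℝ) z.1).prodMk ((hasDerivAt_id (1 : ℝ)).smul_const z.2)
  have h2 : HasDerivAt (fun t : ℝ => f (z.1, t • z.2)) (fderiv ℝ f z (0, z.2)) 1 := by
    have hf' : HasFDerivAt f (fderiv ℝ f z) (z.1, (1 : ℝ) • z.2) := by simpa using hf.hasFDerivAt
    exact hf'.comp_hasDerivAt (1 : ℝ) h1
  have h3 : HasDerivAt (fun t : ℝ => t * f z) (f z) 1 := by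
    simpa using (hasDerivAt_id (1 : ℝ)).mul_const (f z)
  have h4 : (fun t : ℝ => f (z.1, t • z.2)) =ᶠ[𝓝 1] fun t => t * f z := by
    filter_upwards [lt_mem_nhds one_pos] with t ht using hhom t ht
  exact h2.unique (h3.congr_of_eventuallyEq h4)

/-- The base derivatives of a function that is positively homogeneous of degree one are again
positively homogeneous of degree one. -/
theorem baseDeriv_smul_of_homogeneous {f : Coord n × Coord n → ℝ} {x y : Coord n} {a : ℝ}
    (hf : DifferentiableAt ℝ f (x, y)) (hfa : DifferentiableAt ℝ f (x, a • y))
    (hhom : ∀ᶠ x' in 𝓝 x, f (x', a • y) = a * f (x', y)) :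
    baseDeriv f (x, a • y) = a • baseDeriv f (x, y) := by
  have h1 : HasFDerivAt (fun x' => f (x', a • y)) (baseDeriv f (x, a • y)) x :=
    HasFDerivAt.comp (g := f) x hfa.hasFDerivAt (hasFDerivAt_prodMk_left x (a • y))
  have h2 : HasFDerivAt (fun x' => a * f (x', y)) (a • baseDeriv f (x, y)) x :=
    (HasFDerivAt.comp (g := f) x hf.hasFDerivAt (hasFDerivAt_prodMk_left x y)).const_mul a
  exact h1.unique (h2.congr_of_eventuallyEq hhom)

end Homogeneous

/-! ### The Euler-Lagrange equations on phase space -/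

section EulerLagrange

variable {n : ℕ} {U : Set (Coord n × Coord n)} {f : Coord n × Coord n → ℝ}
  {β : Coord n × Coord n → Coord n →L[ℝ] ℝ} {X : Coord n × Coord n → Coord n × Coord n}
  {z : Coord n × Coord n}

/-- The Euler-Lagrange equations of `f` hold at `z` for the curves with velocity `X z` in the phase
space: `X (∂f/∂yⁱ) = ∂f/∂xⁱ`. -/
def EulerLagrangeAt (f : Coord n × Coord n → ℝ) (X : Coord n × Coord n → Coord n × Coord n)
    (z : Coord n × Coord n) : Prop :=
  fderiv ℝ (vertDeriv f) z (X z) = baseDeriv f z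

theorem contDiffOn_vertDeriv (hU : IsOpen U) (hf : ContDiffOn ℝ ∞ f U) :
    ContDiffOn ℝ ∞ (vertDeriv f) U :=
  (hf.fderiv_of_isOpen hU (m := ∞) le_rfl).clm_comp contDiffOn_const

theorem fderiv_vertDeriv_apply (hU : IsOpen U) (hf : ContDiffOn ℝ ∞ f U) (hz : z ∈ U)
    (u : Coord n × Coord n) (w : Coord n) :
    fderiv ℝ (vertDeriv f) z u w = fderiv ℝ (fderiv ℝ f) z u (0, w) := by
  have hd : DifferentiableAt ℝ (fderiv ℝ f) z :=
    ((hf.fderiv_of_isOpen hU (m := ∞) le_rfl).contDiffAt (hU.mem_nhds hz)).differentiableAt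
      (by simp)
  have h : HasFDerivAt (vertDeriv f) (((ContinuousLinearMap.compL ℝ (Coord n) (Coord n × Coord n)
      ℝ).flip (ContinuousLinearMap.inr ℝ (Coord n) (Coord n))).comp (fderiv ℝ (fderiv ℝ f) z)) z :=
    ((ContinuousLinearMap.compL ℝ (Coord n) (Coord n × Coord n)
      ℝ).flip (ContinuousLinearMap.inr ℝ (Coord n) (Coord n))).hasFDerivAt.comp z hd.hasFDerivAt
  rw [h.fderiv]
  simp

theorem fderiv_fderiv_symm {W Z : Type*} [NormedAddCommGroup W] [NormedSpace ℝ W]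
    [NormedAddCommGroup Z] [NormedSpace ℝ Z] {g : W → Z} {z : W} (hg : ContDiffAt ℝ ∞ g z)
    (u w : W) :
    fderiv ℝ (fderiv ℝ g) z u w = fderiv ℝ (fderiv ℝ g) z w u :=
  hg.isSymmSndFDerivAt (by rw [minSmoothness_of_isRCLikeNormedField]; exact ENat.LEInfty.out) u w

theorem vertDeriv_vertDeriv_symm (hU : IsOpen U) (hf : ContDiffOn ℝ ∞ f U) (hz : z ∈ U)
    (u w : Coord n) : vertDeriv (vertDeriv f) z u w = vertDeriv (vertDeriv f) z w u := by
  rw [vertDeriv, ContinuousLinearMap.comp_apply, ContinuousLinearMap.comp_apply,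
    fderiv_vertDeriv_apply hU hf hz, fderiv_vertDeriv_apply hU hf hz]
  exact fderiv_fderiv_symm (hf.contDiffAt (hU.mem_nhds hz)) _ _

theorem vertDeriv_vertDeriv_self (hU : IsOpen U) (hf : ContDiffOn ℝ ∞ f U)
    (heuler : ∀ p ∈ U, vertDeriv f p p.2 = f p) (hz : z ∈ U) :
    vertDeriv (vertDeriv f) z z.2 = 0 := by
  refine ContinuousLinearMap.ext fun w => ?_
  rw [vertDeriv_vertDeriv_symm hU hf hz]
  have hd : DifferentiableAt ℝ (vertDeriv f) z :=
    ((contDiffOn_vertDeriv hU hf).contDiffAt (hU.mem_nhds hz)).differentiableAt (by simp)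
  have h1 : HasFDerivAt (fun p => vertDeriv f p p.2) _ z :=
    hd.hasFDerivAt.clm_apply hasFDerivAt_snd
  have h2 : (fun p => vertDeriv f p p.2) =ᶠ[𝓝 z] f := by
    filter_upwards [hU.mem_nhds hz] with p hp using heuler p hp
  have h3 := congrArg (fun L : (Coord n × Coord n) →L[ℝ] ℝ => L (0, w))
    (h1.fderiv.symm.trans h2.fderiv_eq)
  simp only [add_apply, ContinuousLinearMap.comp_apply, ContinuousLinearMap.flip_apply,
    ContinuousLinearMap.coe_snd'] at h3
  have h4 : fderiv ℝ f z (0, w) = vertDeriv f z w := rfl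
  rw [h4] at h3
  have h5 : fderiv ℝ (vertDeriv f) z (0, w) z.2 = vertDeriv (vertDeriv f) z w z.2 := rfl
  rw [h5] at h3
  simpa using h3

/-- Differentiating the Euler-Lagrange equations in a fibre direction and taking the skew part gives
`H_i (∂f/∂yʲ) = H_j (∂f/∂yⁱ)`; the third derivatives of `f` cancel. -/
theorem fderiv_vertDeriv_horizontalProjector_symm (hU : IsOpen U) (hf : ContDiffOn ℝ ∞ f U)
    (hX : ContDiffOn ℝ ∞ X U) (hX1 : ∀ p ∈ U, (X p).1 = p.2)
    (hEL : ∀ p ∈ U, EulerLagrangeAt f X p) (hz : z ∈ U) (u w : Coord n × Coord n) :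
    fderiv ℝ (vertDeriv f) z (horizontalProjector X z u) w.1 =
      fderiv ℝ (vertDeriv f) z (horizontalProjector X z w) u.1 := by
  have hmem := hU.mem_nhds hz
  have hf1 : ContDiffOn ℝ ∞ (fderiv ℝ f) U := hf.fderiv_of_isOpen hU le_rfl
  have hf2 : ContDiffOn ℝ ∞ (fderiv ℝ (fderiv ℝ f)) U := hf1.fderiv_of_isOpen hU le_rfl
  have hd1 : DifferentiableAt ℝ (fderiv ℝ f) z := (hf1.contDiffAt hmem).differentiableAt (by simp)
  have hd2 : DifferentiableAt ℝ (fderiv ℝ (fderiv ℝ f)) z :=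
    (hf2.contDiffAt hmem).differentiableAt (by simp)
  have hdX : DifferentiableAt ℝ X z := (hX.contDiffAt hmem).differentiableAt (by simp)
  -- the third derivative is symmetric in its last two arguments, and in its first two
  have h3a : ∀ a b c, fderiv ℝ (fderiv ℝ (fderiv ℝ f)) z a b c =
      fderiv ℝ (fderiv ℝ (fderiv ℝ f)) z a c b := by
    intro a b c
    have h1 := ((hd2.hasFDerivAt.clm_apply (hasFDerivAt_const b z)).clm_apply
      (hasFDerivAt_const c z)).fderiv
    have h2 := ((hd2.hasFDerivAt.clm_apply (hasFDerivAt_const c z)).clm_apply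
      (hasFDerivAt_const b z)).fderiv
    have h3 : (fun p => fderiv ℝ (fderiv ℝ f) p b c) =ᶠ[𝓝 z]
        fun p => fderiv ℝ (fderiv ℝ f) p c b := by
      filter_upwards [hmem] with p hp
        using fderiv_fderiv_symm (hf.contDiffAt (hU.mem_nhds hp)) b c
    have h4 := congrArg (fun L : (Coord n × Coord n) →L[ℝ] ℝ => L a)
      (h1.symm.trans (h3.fderiv_eq.trans h2))
    simpa using h4
  have h3b : ∀ a b, fderiv ℝ (fderiv ℝ (fderiv ℝ f)) z a b =
      fderiv ℝ (fderiv ℝ (fderiv ℝ f)) z b a :=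
    fun a b => fderiv_fderiv_symm (hf1.contDiffAt hmem) a b
  have hX' : ∀ u : Coord n, fderiv ℝ X z (0, u) =
      (u, (-2 : ℝ) • vertDeriv (sprayCoeff X) z u) := by
    intro u
    have h1 : HasFDerivAt (fun p => (X p).1)
        ((ContinuousLinearMap.fst ℝ (Coord n) (Coord n)).comp (fderiv ℝ X z)) z :=
      hasFDerivAt_fst.comp z hdX.hasFDerivAt
    have h2 : HasFDerivAt (sprayCoeff X) ((-(1 / 2 : ℝ)) •
        ((ContinuousLinearMap.snd ℝ (Coord n) (Coord n)).comp (fderiv ℝ X z))) z :=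
      HasFDerivAt.fun_const_smul (f := fun p => (X p).2) (hasFDerivAt_snd.comp z hdX.hasFDerivAt)
        (-(1 / 2 : ℝ))
    have h3 : (fun p => (X p).1) =ᶠ[𝓝 z] Prod.snd := by
      filter_upwards [hmem] with p hp using hX1 p hp
    have h4 := congrArg (fun L : (Coord n × Coord n) →L[ℝ] Coord n => L (0, u))
      (h1.fderiv.symm.trans (h3.fderiv_eq.trans hasFDerivAt_snd.fderiv))
    ext1
    · simpa using h4
    · rw [vertDeriv, h2.fderiv]
      simp [smul_smul]
  have key : ∀ u w : Coord n,
      fderiv ℝ (fderiv ℝ (fderiv ℝ f)) z (0, u) (X z) (0, w) +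
        fderiv ℝ (fderiv ℝ f) z (u, (-2 : ℝ) • vertDeriv (sprayCoeff X) z u) (0, w) =
      fderiv ℝ (fderiv ℝ f) z (0, u) (w, 0) := by
    intro u w
    have h1 := ((hd2.hasFDerivAt.clm_apply hdX.hasFDerivAt).clm_apply
      (hasFDerivAt_const ((0, w) : Coord n × Coord n) z)).fderiv
    have h2 := (hd1.hasFDerivAt.clm_apply
      (hasFDerivAt_const ((w, 0) : Coord n × Coord n) z)).fderiv
    have h3 : (fun p => fderiv ℝ (fderiv ℝ f) p (X p) (0, w)) =ᶠ[𝓝 z]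
        fun p => fderiv ℝ f p (w, 0) := by
      filter_upwards [hmem] with p hp
      rw [← fderiv_vertDeriv_apply hU hf hp, hEL p hp]
      rfl
    have h4 := congrArg (fun L : (Coord n × Coord n) →L[ℝ] ℝ => L (0, u))
      (h1.symm.trans (h3.fderiv_eq.trans h2))
    rw [← hX']
    simpa [add_comm] using h4
  rw [fderiv_vertDeriv_apply hU hf hz, fderiv_vertDeriv_apply hU hf hz]
  have hsplit : ∀ (u : Coord n × Coord n) (w : Coord n),
      fderiv ℝ (fderiv ℝ f) z (horizontalProjector X z u) (0, w) =
        fderiv ℝ (fderiv ℝ f) z (u.1, 0) (0, w) -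
          fderiv ℝ (fderiv ℝ f) z (0, vertDeriv (sprayCoeff X) z u.1) (0, w) := by
    intro u w
    rw [← sub_apply, ← map_sub]
    simp [horizontalProjector]
  have hsplit2 : ∀ u w : Coord n,
      fderiv ℝ (fderiv ℝ f) z (u, (-2 : ℝ) • vertDeriv (sprayCoeff X) z u) (0, w) =
        fderiv ℝ (fderiv ℝ f) z (u, 0) (0, w) -
          2 * fderiv ℝ (fderiv ℝ f) z (0, vertDeriv (sprayCoeff X) z u) (0, w) := by
    intro u w
    have : (u, (-2 : ℝ) • vertDeriv (sprayCoeff X) z u) =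
        (u, 0) - (2 : ℝ) • ((0, vertDeriv (sprayCoeff X) z u) : Coord n × Coord n) := by
      simp
    rw [this, map_sub, map_smul]
    simp
  have hs : ∀ u w : Coord n, fderiv ℝ (fderiv ℝ f) z (0, u) (w, 0) =
      fderiv ℝ (fderiv ℝ f) z (w, 0) (0, u) :=
    fun u w => fderiv_fderiv_symm (hf.contDiffAt hmem) _ _
  have k1 := key u.1 w.1
  have k2 := key w.1 u.1
  rw [hs, hsplit2] at k1 k2
  have k3 : fderiv ℝ (fderiv ℝ (fderiv ℝ f)) z (0, u.1) (X z) (0, w.1) =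
      fderiv ℝ (fderiv ℝ (fderiv ℝ f)) z (0, w.1) (X z) (0, u.1) := by
    rw [h3a, h3b, h3a]
  rw [hsplit, hsplit]
  linarith

end EulerLagrange

section OfForm

variable {n : ℕ} {U : Set (Coord n × Coord n)}
  {β : Coord n × Coord n → Coord n →L[ℝ] ℝ} {X : Coord n × Coord n → Coord n × Coord n}
  {z : Coord n × Coord n}

theorem hasFDerivAt_contraction (hβ : DifferentiableAt ℝ β z) :
    HasFDerivAt (fun p => β p p.2) ((β z).comp (ContinuousLinearMap.snd ℝ (Coord n) (Coord n)) +
      (fderiv ℝ β z).flip z.2) z :=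
  hβ.hasFDerivAt.clm_apply hasFDerivAt_snd

/-- `∂/∂yⁱ (β_j yʲ) = β_i + yʲ V_i β_j = β_i`. -/
theorem vertDeriv_contraction (hβ : DifferentiableAt ℝ β z)
    (hsymm : ∀ u w, vertDeriv β z u w = vertDeriv β z w u) (hL : vertDeriv β z z.2 = 0) :
    vertDeriv (fun p => β p p.2) z = β z := by
  refine ContinuousLinearMap.ext fun w => ?_
  rw [vertDeriv, (hasFDerivAt_contraction hβ).fderiv]
  have : fderiv ℝ β z (0, w) z.2 = 0 := (hsymm w z.2).trans (by rw [hL]; rfl)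
  simp [this]

/-- Contracting `H_i β_j = H_j β_i` with `yⁱ` gives the Euler-Lagrange equations of `β_i yⁱ` for a
field `X = yⁱ H_i`. -/
theorem eulerLagrangeAt_contraction (hU : IsOpen U) (hβ : DifferentiableOn ℝ β U)
    (hsymm : ∀ p ∈ U, ∀ u w, vertDeriv β p u w = vertDeriv β p w u)
    (hL : ∀ p ∈ U, vertDeriv β p p.2 = 0)
    (hH : ∀ p ∈ U, ∀ u w : Coord n × Coord n, fderiv ℝ β p (horizontalProjector X p u) w.1 =
      fderiv ℝ β p (horizontalProjector X p w) u.1)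
    (hXd : ∀ p ∈ U, horizontalProjector X p (p.2, 0) = X p)
    (hz : z ∈ U) : EulerLagrangeAt (fun p => β p p.2) X z := by
  have hd : DifferentiableAt ℝ β z := (hβ z hz).differentiableAt (hU.mem_nhds hz)
  have h1 : vertDeriv (fun p => β p p.2) =ᶠ[𝓝 z] β := by
    filter_upwards [hU.mem_nhds hz] with p hp
    exact vertDeriv_contraction ((hβ p hp).differentiableAt (hU.mem_nhds hp)) (hsymm p hp) (hL p hp)
  rw [EulerLagrangeAt, h1.fderiv_eq]
  refine ContinuousLinearMap.ext fun w => ?_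
  rw [← hXd z hz]
  have h2 := hH z hz (z.2, 0) (w, 0)
  rw [h2, baseDeriv, (hasFDerivAt_contraction hd).fderiv]
  have h3 : horizontalProjector X z (w, 0) = (w, 0) + (0, -vertDeriv (sprayCoeff X) z w) := by
    simp [horizontalProjector]
  have h4 : fderiv ℝ β z (0, -vertDeriv (sprayCoeff X) z w) z.2 = 0 :=
    (hsymm z hz _ z.2).trans (by rw [hL z hz]; rfl)
  rw [h3, map_add, add_apply]
  dsimp only
  rw [h4]
  simp

end OfForm

/-! ### Reparametrization of an interval -/

/-- The differential equation `φ'' = p(φ) φ'²` is solved by an increasing bijection of an open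
interval onto `s`: its inverse is a primitive of `exp (-∫ p)`. -/
theorem exists_reparametrization {s : Set ℝ} (hs : IsOpenInterval s) {p : ℝ → ℝ}
    (hp : ContinuousOn p s) :
    ∃ (φ g : ℝ → ℝ) (s' : Set ℝ), IsOpenInterval s' ∧ BijOn φ s' s ∧
      ∀ r ∈ s', 0 < g r ∧ HasDerivAt φ (g r) r ∧ HasDerivAt g (g r ^ 2 * p (φ r)) r := by
  obtain ⟨ho, hc⟩ := hs
  rcases s.eq_empty_or_nonempty with rfl | ⟨t₀, ht₀⟩
  · exact ⟨id, id, ∅, ⟨ho, hc⟩, bijOn_empty _, by simp⟩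
  have hprim : ∀ f : ℝ → ℝ, ContinuousOn f s → ∀ t ∈ s,
      HasDerivAt (fun t => ∫ x in t₀..t, f x) (f t) t := fun f hf t ht =>
    intervalIntegral.integral_hasDerivAt_right
      ((hf.mono (hc.uIcc_subset ht₀ ht)).intervalIntegrable)
      (hf.stronglyMeasurableAtFilter ho t ht) (hf.continuousAt (ho.mem_nhds ht))
  let q : ℝ → ℝ := fun t => ∫ x in t₀..t, p x
  have hq : ∀ t ∈ s, HasDerivAt q (p t) t := hprim p hp
  have hqc : ContinuousOn (fun t => Real.exp (-q t)) s := fun t ht =>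
    ((hq t ht).continuousAt.neg.rexp).continuousWithinAt
  let ψ : ℝ → ℝ := fun t => ∫ x in t₀..t, Real.exp (-q x)
  have hψ : ∀ t ∈ s, HasDerivAt ψ (Real.exp (-q t)) t := hprim _ hqc
  have hψc : ContinuousOn ψ s := fun t ht => (hψ t ht).continuousAt.continuousWithinAt
  have hmono : StrictMonoOn ψ s := by
    refine strictMonoOn_of_deriv_pos hc.convex hψc fun t ht => ?_
    rw [(hψ t (interior_subset ht)).deriv]
    exact Real.exp_pos _
  have hbij : BijOn ψ s (ψ '' s) := hmono.injOn.bijOn_image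
  have hinv := hbij.invOn_invFunOn
  set φ := Function.invFunOn ψ s
  have hφ : BijOn φ (ψ '' s) s := hbij.symm hinv.symm
  have hopen : IsOpen (ψ '' s) := by
    rw [isOpen_iff_mem_nhds]
    rintro _ ⟨t, ht, rfl⟩
    have hstrict : HasStrictDerivAt ψ (Real.exp (-q t)) t :=
      hasStrictDerivAt_of_hasDerivAt_of_continuousAt
        (by filter_upwards [ho.mem_nhds ht] with x hx using hψ x hx)
        (hqc.continuousAt (ho.mem_nhds ht))
    rw [← hstrict.map_nhds_eq (Real.exp_ne_zero _)]
    exact image_mem_map (ho.mem_nhds ht)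
  have hφmono : StrictMonoOn φ (ψ '' s) := by
    rintro _ ⟨a, ha, rfl⟩ _ ⟨b, hb, rfl⟩ hab
    rw [hinv.1 ha, hinv.1 hb]
    exact (hmono.lt_iff_lt ha hb).1 hab
  have hφd : ∀ r ∈ ψ '' s, HasDerivAt φ (Real.exp (q (φ r))) r := by
    intro r hr
    have hcont : ContinuousAt φ r := hφmono.continuousAt_of_image_mem_nhds (hopen.mem_nhds hr)
      (by rw [hφ.image_eq]; exact ho.mem_nhds (hφ.mapsTo hr))
    have h := HasDerivAt.of_local_left_inverse hcont (hψ _ (hφ.mapsTo hr)) (Real.exp_ne_zero _)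
      (by filter_upwards [hopen.mem_nhds hr] with y hy using hinv.2 hy)
    rwa [Real.exp_neg, inv_inv] at h
  refine ⟨φ, fun r => Real.exp (q (φ r)), ψ '' s, ⟨hopen, ?_⟩, hφ, fun r hr =>
    ⟨Real.exp_pos _, hφd r hr, ?_⟩⟩
  · exact (hc.isPreconnected.image ψ hψc).ordConnected
  · have h := ((hq _ (hφ.mapsTo hr)).comp r (hφd r hr)).exp
    convert! h using 1
    simp only [Function.comp_apply]
    ring

section Geometry

variable {n : ℕ} {M : Type*} [TopologicalSpace M] [ChartedSpace (Coord n) M]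
  [IsManifold (𝓡 n) ∞ M]

/-! ### Charts of the tangent bundle -/

theorem mem_tangentChart_source {c : M} {v : TangentBundle (𝓡 n) M} :
    v ∈ (tangentChart c).source ↔ v.proj ∈ (extChartAt (𝓡 n) c).source := by
  simp [tangentChart]

theorem mem_tangentChart_target {c : M} {z : Coord n × Coord n} :
    z ∈ (tangentChart c).target ↔ z.1 ∈ (extChartAt (𝓡 n) c).target := by
  have h := TangentBundle.mem_chart_target_iff (I := 𝓡 n) z (⟨c, 0⟩ : TangentBundle (𝓡 n) M)
  rw [tangentChart, extChartAt_target, extChartAt_target]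
  rw [show (𝓡 n).tangent.symm ⁻¹' (chartAt (ModelProd (Coord n) (Coord n))
    (⟨c, 0⟩ : TangentBundle (𝓡 n) M)).target ∩ range (𝓡 n).tangent =
    (chartAt (ModelProd (Coord n) (Coord n)) (⟨c, 0⟩ : TangentBundle (𝓡 n) M)).target by
      rw [ModelWithCorners.range_eq_univ, inter_univ]; rfl]
  simpa only [ModelWithCorners.range_eq_univ, inter_univ] using! h

theorem tangentChart_apply (c : M) (v : TangentBundle (𝓡 n) M) :
    tangentChart c v =
      (extChartAt (𝓡 n) c v.proj, tangentCoordChange (𝓡 n) v.proj c v.proj v.snd) := by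
  rfl

theorem isOpen_tangentChart_source (c : M) :
    IsOpen (tangentChart (n := n) c).source := isOpen_extChartAt_source _

theorem isOpen_tangentChart_target (c : M) :
    IsOpen (tangentChart (n := n) c).target := isOpen_extChartAt_target _

/-- The linear isomorphism from the fibre coordinates `y` of the chart around `c` to the tangent
space at `p`; the fibre part of `tangentChart c` is its inverse. -/
def fiberEquiv (c p : M) (hp : p ∈ (extChartAt (𝓡 n) c).source) :
    Coord n ≃L[ℝ] TangentSpace (𝓡 n) p :=
  have h := mem_extChartAt_source (I := 𝓡 n) p
  (ContinuousLinearEquiv.equivOfInverse (tangentCoordChange (𝓡 n) c p p)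
    (tangentCoordChange (𝓡 n) p c p)
    (fun w => by rw [tangentCoordChange_comp ⟨⟨hp, h⟩, hp⟩, tangentCoordChange_self hp])
    (fun w => by rw [tangentCoordChange_comp ⟨⟨h, hp⟩, h⟩, tangentCoordChange_self h]) :
    Coord n ≃L[ℝ] Coord n)

theorem tangentChart_symm_apply {c : M} {z : Coord n × Coord n}
    (hz : z.1 ∈ (extChartAt (𝓡 n) c).target) :
    (tangentChart c).symm z = ⟨(extChartAt (𝓡 n) c).symm z.1,
      fiberEquiv c _ ((extChartAt (𝓡 n) c).map_target hz) z.2⟩ := by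
  have hs := (extChartAt (𝓡 n) c).map_target hz
  have h := (tangentChart c).left_inv (x := ⟨(extChartAt (𝓡 n) c).symm z.1,
    fiberEquiv c _ hs z.2⟩) (mem_tangentChart_source.2 hs)
  rw [← h, tangentChart_apply]
  congr 1
  ext1
  · exact ((extChartAt (𝓡 n) c).right_inv hz).symm
  · exact ((fiberEquiv c _ hs).symm_apply_apply z.2).symm

theorem tangentChart_snd_eq_zero {c : M} {v : TangentBundle (𝓡 n) M}
    (hv : v ∈ (tangentChart c).source) : (tangentChart c v).2 = 0 ↔ v.snd = 0 :=
  (fiberEquiv c v.proj (mem_tangentChart_source.1 hv)).symm.map_eq_zero_iff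

theorem mem_chartDomain {c : M} {z : Coord n × Coord n} :
    z ∈ chartDomain c ↔ z ∈ (tangentChart c).target ∧ z.2 ≠ 0 := by
  refine and_congr_right fun hz => ?_
  have h := tangentChart_snd_eq_zero ((tangentChart c).map_target hz)
  rw [(tangentChart c).right_inv hz] at h
  exact h.not.symm

theorem isOpen_chartDomain (c : M) : IsOpen (chartDomain (n := n) c) := by
  have : chartDomain (n := n) c = (tangentChart c).target ∩ {z | z.2 ≠ 0} := by
    ext z; exact mem_chartDomain
  rw [this]
  exact (isOpen_tangentChart_target c).inter (isOpen_ne_fun continuous_snd continuous_const)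

theorem tangentChart_mem_chartDomain {c : M} {v : TangentBundle (𝓡 n) M}
    (hv : v ∈ (tangentChart c).source) (h0 : v ∈ slit n M) :
    tangentChart c v ∈ chartDomain c :=
  mem_chartDomain.2 ⟨(tangentChart c).map_source hv, (tangentChart_snd_eq_zero hv).not.2 h0⟩

theorem mem_tangentChart_source_self (v : TangentBundle (𝓡 n) M) :
    v ∈ (tangentChart v.proj).source :=
  mem_tangentChart_source.2 (mem_extChartAt_source _)

theorem isOpen_slit : IsOpen (slit n M) := by
  rw [isOpen_iff_mem_nhds]
  intro v hv
  have hs := mem_tangentChart_source_self v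
  have hc : ContinuousAt (tangentChart v.proj) v :=
    continuousAt_extChartAt' (I := (𝓡 n).tangent) hs
  filter_upwards [(isOpen_tangentChart_source _).mem_nhds hs,
    hc.preimage_mem_nhds ((isOpen_chartDomain v.proj).mem_nhds
      (tangentChart_mem_chartDomain hs hv))] with w hw hw'
  exact (tangentChart_snd_eq_zero hw).not.1 (mem_chartDomain.1 hw').2

theorem contMDiffAt_tangentChart {c : M} {v : TangentBundle (𝓡 n) M}
    (hv : v ∈ (tangentChart c).source) :
    ContMDiffAt (𝓡 n).tangent 𝓘(ℝ, Coord n × Coord n) ∞ (tangentChart c) v := 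
  contMDiffAt_extChartAt' (I := (𝓡 n).tangent) (by simpa [tangentChart, extChartAt_source] using hv)

theorem contMDiffAt_tangentChart_symm {c : M} {z : Coord n × Coord n}
    (hz : z ∈ (tangentChart c).target) :
    ContMDiffAt 𝓘(ℝ, Coord n × Coord n) (𝓡 n).tangent ∞ (tangentChart c).symm z :=
  (contMDiffOn_extChartAt_symm (I := (𝓡 n).tangent) _ z hz).contMDiffAt
    ((isOpen_tangentChart_target c).mem_nhds hz)

theorem isInvertible_mfderiv_tangentChart_symm {c : M} {z : Coord n × Coord n}
    (hz : z ∈ (tangentChart c).target) :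
    (mfderiv 𝓘(ℝ, Coord n × Coord n) (𝓡 n).tangent (tangentChart c).symm z).IsInvertible := by
  have := isInvertible_mfderivWithin_extChartAt_symm (I := (𝓡 n).tangent) hz
  rwa [ModelWithCorners.range_eq_univ, mfderivWithin_univ] at this

theorem mfderiv_symm_fieldCoord (X : Field n M) {c : M} {z : Coord n × Coord n}
    (hz : z ∈ (tangentChart c).target) :
    mfderiv 𝓘(ℝ, Coord n × Coord n) (𝓡 n).tangent (tangentChart c).symm z (fieldCoord X c z) =
      X ((tangentChart c).symm z) := by
  obtain ⟨e, he⟩ := isInvertible_mfderiv_tangentChart_symm hz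
  simp only [fieldCoord, VectorField.mpullback_apply]
  rw [← he]
  simp

/-- In the coordinates of the charts the projection of `TM` to `M` is `(x, y) ↦ x`. -/
theorem mfderiv_proj_symm {c : M} {z : Coord n × Coord n}
    (hz : z ∈ (tangentChart c).target) (u : Coord n × Coord n) :
    mfderiv (𝓡 n).tangent (𝓡 n) (Bundle.TotalSpace.proj : TangentBundle (𝓡 n) M → M)
      ((tangentChart c).symm z)
      (mfderiv 𝓘(ℝ, Coord n × Coord n) (𝓡 n).tangent (tangentChart c).symm z u) =
      fiberEquiv c _ ((extChartAt (𝓡 n) c).map_target (mem_tangentChart_target.1 hz)) u.1 := by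
  have hz' := mem_tangentChart_target.1 hz
  have hs := (extChartAt (𝓡 n) c).map_target hz'
  have h1 : MDifferentiableAt (𝓡 n).tangent (𝓡 n)
      (Bundle.TotalSpace.proj : TangentBundle (𝓡 n) M → M) ((tangentChart c).symm z) :=
    (Bundle.contMDiffAt_proj (n := ∞) _).mdifferentiableAt (by simp)
  have h2 : MDifferentiableAt 𝓘(ℝ, Coord n × Coord n) (𝓡 n).tangent (tangentChart c).symm z :=
    (contMDiffAt_tangentChart_symm hz).mdifferentiableAt (by simp)
  have h3 : MDifferentiableAt 𝓘(ℝ, Coord n) (𝓡 n) (extChartAt (𝓡 n) c).symm z.1 := by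
    have := mdifferentiableWithinAt_extChartAt_symm (I := 𝓡 n) hz'
    rwa [ModelWithCorners.range_eq_univ, mdifferentiableWithinAt_univ] at this
  have e1 : mfderiv 𝓘(ℝ, Coord n × Coord n) (𝓡 n)
      (Bundle.TotalSpace.proj ∘ (tangentChart c).symm) z = _ := mfderiv_comp z h1 h2
  have h4 : HasMFDerivAt 𝓘(ℝ, Coord n × Coord n) 𝓘(ℝ, Coord n)
      (Prod.fst : Coord n × Coord n → Coord n) z (ContinuousLinearMap.fst ℝ (Coord n) (Coord n)) :=
    hasFDerivAt_fst.hasMFDerivAt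
  have e2 := (HasMFDerivAt.comp (g := (extChartAt (𝓡 n) c).symm) z h3.hasMFDerivAt h4).mfderiv
  have e3 : (tangentCoordChange (𝓡 n) c ((extChartAt (𝓡 n) c).symm z.1)
      ((extChartAt (𝓡 n) c).symm z.1) : Coord n →L[ℝ] Coord n) =
      mfderiv 𝓘(ℝ, Coord n) (𝓡 n) (extChartAt (𝓡 n) c).symm z.1 := by
    have hs' := hs
    rw [extChartAt_source] at hs'
    have a := TangentBundle.symmL_trivializationAt (I := 𝓡 n) hs'
    have b := TangentBundle.symmL_trivializationAt_eq_core (I := 𝓡 n) hs'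
    rw [ModelWithCorners.range_eq_univ, mfderivWithin_univ,
      (extChartAt (𝓡 n) c).right_inv hz'] at a
    exact b.symm.trans a
  have e4 : mfderiv (𝓡 n).tangent (𝓡 n) (Bundle.TotalSpace.proj : TangentBundle (𝓡 n) M → M)
      ((tangentChart c).symm z)
      (mfderiv 𝓘(ℝ, Coord n × Coord n) (𝓡 n).tangent (tangentChart c).symm z u) =
      mfderiv 𝓘(ℝ, Coord n × Coord n) (𝓡 n)
      (Bundle.TotalSpace.proj ∘ (tangentChart c).symm) z u := by rw [e1]; rfl
  refine e4.trans ?_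
  have e5 : mfderiv 𝓘(ℝ, Coord n × Coord n) (𝓡 n)
      (Bundle.TotalSpace.proj ∘ (tangentChart (M := M) c).symm) z u =
      mfderiv 𝓘(ℝ, Coord n) (𝓡 n) (extChartAt (𝓡 n) c).symm z.1 u.1 :=
    congrArg (fun L : (Coord n × Coord n) →L[ℝ] Coord n => L u) e2
  refine e5.trans ?_
  exact (congrArg (fun L : Coord n →L[ℝ] Coord n => L u.1) e3).symm

theorem tangentChart_symm_smul {c : M} {z : Coord n × Coord n} (hz : z ∈ (tangentChart c).target)
    (a : ℝ) : (tangentChart c).symm (z.1, a • z.2) =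
      ⟨((tangentChart c).symm z).proj, a • ((tangentChart c).symm z).snd⟩ := by
  have hz' := mem_tangentChart_target.1 hz
  rw [tangentChart_symm_apply (z := (z.1, a • z.2)) hz', tangentChart_symm_apply (z := z) hz',
    map_smul]

theorem smul_mem_chartDomain {c : M} {z : Coord n × Coord n} (hz : z ∈ chartDomain c) {a : ℝ}
    (ha : 0 < a) : (z.1, a • z.2) ∈ chartDomain c := by
  rw [mem_chartDomain, mem_tangentChart_target] at hz ⊢
  exact ⟨hz.1, smul_ne_zero ha.ne' hz.2⟩

section Differentiability

variable {W : Type*} [NormedAddCommGroup W] [NormedSpace ℝ W]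

theorem differentiableAt_of_contDiffOn_chartDomain {g : Coord n × Coord n → W} {c : M}
    (hg : ContDiffOn ℝ ∞ g (chartDomain c)) {z : Coord n × Coord n} (hz : z ∈ chartDomain c) :
    DifferentiableAt ℝ g z :=
  (hg.contDiffAt ((isOpen_chartDomain c).mem_nhds hz)).differentiableAt (by simp)

end Differentiability

/-! ### Vector fields and sprays in coordinates -/

theorem fieldCoord_eq_of_mfderiv_symm_eq {X : Field n M} {c : M} {z u : Coord n × Coord n}
    (hz : z ∈ (tangentChart c).target)
    (h : mfderiv 𝓘(ℝ, Coord n × Coord n) (𝓡 n).tangent (tangentChart c).symm z u =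
      X ((tangentChart c).symm z)) : fieldCoord X c z = u := by
  obtain ⟨e, he⟩ := isInvertible_mfderiv_tangentChart_symm hz
  rw [← mfderiv_symm_fieldCoord X hz, ← he] at h
  exact (e.injective h).symm

theorem hasMFDerivAt_tangentChart_symm_comp {c : M} {z u : Coord n × Coord n}
    (hz : z ∈ (tangentChart c).target) {f : ℝ → Coord n × Coord n} {t : ℝ} (hfz : f t = z)
    (hf : HasDerivAt f u t) :
    HasMFDerivAt 𝓘(ℝ, ℝ) (𝓡 n).tangent (fun r => (tangentChart c).symm (f r)) t
      ((1 : ℝ →L[ℝ] ℝ).smulRight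
        (mfderiv 𝓘(ℝ, Coord n × Coord n) (𝓡 n).tangent (tangentChart c).symm z u) :
        ℝ →L[ℝ] Coord n × Coord n) := by
  subst hfz
  have h2 := ((contMDiffAt_tangentChart_symm hz).mdifferentiableAt (by simp)).hasMFDerivAt
  refine (h2.comp t (hasDerivAt_iff_hasFDerivAt.1 hf).hasMFDerivAt).congr_mfderiv ?_
  refine ContinuousLinearMap.ext fun r => ?_
  exact (mfderiv 𝓘(ℝ, Coord n × Coord n) (𝓡 n).tangent (tangentChart c).symm (f t)).map_smul r u

theorem fieldCoord_liouville {c : M} {z : Coord n × Coord n} (hz : z ∈ (tangentChart c).target) :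
    fieldCoord liouville c z = liouvilleCoord z := by
  refine fieldCoord_eq_of_mfderiv_symm_eq hz ?_
  have hz' := mem_tangentChart_target.1 hz
  have hcurve : (fun t : ℝ => (⟨((tangentChart c).symm z).proj, t • ((tangentChart c).symm z).snd⟩ :
      TangentBundle (𝓡 n) M)) = (tangentChart c).symm ∘ fun t : ℝ => (z.1, t • z.2) := by
    funext t
    rw [Function.comp_apply, tangentChart_symm_apply (z := (z.1, t • z.2)) hz',
      tangentChart_symm_apply (z := z) hz', map_smul]
  have h3 : HasDerivAt (fun t : ℝ => (z.1, t • z.2)) (0, z.2) 1 := by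
    simpa using (hasDerivAt_const (1 : ℝ) z.1).prodMk ((hasDerivAt_id (1 : ℝ)).smul_const z.2)
  have e := (hasMFDerivAt_tangentChart_symm_comp hz (by simp) h3).mfderiv
  rw [liouville, hcurve]
  refine Eq.trans ?_ (congrArg (fun L : ℝ →L[ℝ] (Coord n × Coord n) => L 1) e).symm
  exact (one_smul ℝ (mfderiv 𝓘(ℝ, Coord n × Coord n) (𝓡 n).tangent (tangentChart c).symm z
    (0, z.2) : Coord n × Coord n)).symm

theorem IsSpray.fieldCoord_fst {Γ : Field n M} (hΓ : IsSpray Γ) {c : M} {z : Coord n × Coord n}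
    (hz : z ∈ chartDomain c) : (fieldCoord Γ c z).1 = z.2 := by
  have h := hΓ.secondOrder _ hz.2
  rw [← mfderiv_symm_fieldCoord Γ hz.1, mfderiv_proj_symm hz.1] at h
  refine (fiberEquiv c _ ((extChartAt (𝓡 n) c).map_target
    (mem_tangentChart_target.1 hz.1))).injective (h.trans ?_)
  rw [tangentChart_symm_apply (mem_tangentChart_target.1 hz.1)]

theorem IsSpray.contMDiffAt {Γ : Field n M} (hΓ : IsSpray Γ) {v : TangentBundle (𝓡 n) M}
    (hv : v ∈ slit n M) : ContMDiffAt (𝓡 n).tangent (𝓡 n).tangent.tangent ∞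
    (fun v => (⟨v, Γ v⟩ : TangentBundle (𝓡 n).tangent (TangentBundle (𝓡 n) M))) v :=
  (hΓ.smooth v hv).contMDiffAt (isOpen_slit.mem_nhds hv)

theorem contDiffAt_fieldCoord {X : Field n M} {c : M} {z : Coord n × Coord n}
    (hz : z ∈ (tangentChart c).target)
    (hX : ContMDiffAt (𝓡 n).tangent (𝓡 n).tangent.tangent ∞
      (fun v => (⟨v, X v⟩ : TangentBundle (𝓡 n).tangent (TangentBundle (𝓡 n) M)))
      ((tangentChart c).symm z)) :
    ContDiffAt ℝ ∞ (fieldCoord X c) z := by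
  have h := ContMDiffAt.mpullback_vectorField_preimage (n := ∞) (m := ∞) hX
    (contMDiffAt_tangentChart_symm hz) (isInvertible_mfderiv_tangentChart_symm hz) le_rfl
  exact contMDiffAt_vectorSpace_iff_contDiffAt.1 h

theorem IsSpray.contDiffOn_fieldCoord {Γ : Field n M} (hΓ : IsSpray Γ) (c : M) :
    ContDiffOn ℝ ∞ (fieldCoord Γ c) (chartDomain c) := fun _ hz =>
  (contDiffAt_fieldCoord hz.1 (hΓ.contMDiffAt hz.2)).contDiffWithinAt

theorem mfderiv_tangentChart_comp_symm {c : M} {z : Coord n × Coord n}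
    (hz : z ∈ (tangentChart c).target) (u : Coord n × Coord n) :
    mfderiv (𝓡 n).tangent 𝓘(ℝ, Coord n × Coord n) (tangentChart c) ((tangentChart c).symm z)
      (mfderiv 𝓘(ℝ, Coord n × Coord n) (𝓡 n).tangent (tangentChart c).symm z u) = u := by
  have h := mfderiv_extChartAt_comp_mfderivWithin_extChartAt_symm (I := (𝓡 n).tangent) hz
  rw [ModelWithCorners.range_eq_univ, mfderivWithin_univ] at h
  exact congrArg (fun L : (Coord n × Coord n) →L[ℝ] (Coord n × Coord n) => L u) h

/-- The Liouville field is smooth: in the charts of `TM` it is the pullback of the field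
`(x, y) ↦ (0, y)`. -/
theorem contMDiffAt_liouville (v : TangentBundle (𝓡 n) M) :
    ContMDiffAt (𝓡 n).tangent (𝓡 n).tangent.tangent ∞
    (fun v => (⟨v, liouville v⟩ : TangentBundle (𝓡 n).tangent (TangentBundle (𝓡 n) M))) v := by
  have hs := mem_tangentChart_source_self v
  have hinv : ∀ w ∈ (tangentChart v.proj).source,
      (mfderiv (𝓡 n).tangent 𝓘(ℝ, Coord n × Coord n) (tangentChart v.proj) w).IsInvertible :=
    fun w hw => isInvertible_mfderiv_extChartAt (I := (𝓡 n).tangent) hw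
  have hV : ContMDiffAt 𝓘(ℝ, Coord n × Coord n) 𝓘(ℝ, Coord n × Coord n).tangent ∞
      (fun z => (⟨z, liouvilleCoord z⟩ :
        TangentBundle 𝓘(ℝ, Coord n × Coord n) (Coord n × Coord n))) (tangentChart v.proj v) :=
    contMDiffAt_vectorSpace_iff_contDiffAt.2
      ((contDiff_const.prodMk contDiff_snd).contDiffAt)
  have h := ContMDiffAt.mpullback_vectorField_preimage (n := ∞) (m := ∞) hV
    (contMDiffAt_tangentChart hs) (hinv v hs) le_rfl
  refine h.congr_of_eventuallyEq ?_
  filter_upwards [(isOpen_tangentChart_source _).mem_nhds hs] with w hw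
  have hwt := (tangentChart v.proj).map_source hw
  have h1 := mfderiv_symm_fieldCoord (liouville : Field n M) hwt
  rw [fieldCoord_liouville hwt] at h1
  have h2 := mfderiv_tangentChart_comp_symm hwt (liouvilleCoord (tangentChart v.proj w))
  rw [h1, (tangentChart v.proj).left_inv hw] at h2
  obtain ⟨e, he⟩ := hinv w hw
  congr 1
  refine (e.symm_apply_apply (liouville w)).symm.trans ?_
  refine Eq.trans ?_ (congrArg (mfderiv (𝓡 n).tangent 𝓘(ℝ, Coord n × Coord n)
    (tangentChart v.proj) w).inverse h2)
  rw [← he, ContinuousLinearMap.inverse_equiv]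
  rfl

/-- The homogeneity condition `[Δ, Γ] = Γ` in the coordinates of an arbitrary chart. -/
theorem IsSpray.lieBracket_fieldCoord {Γ : Field n M} (hΓ : IsSpray Γ) {c : M}
    {z : Coord n × Coord n} (hz : z ∈ chartDomain c) :
    fderiv ℝ (fieldCoord Γ c) z (0, z.2) - (0, (fieldCoord Γ c z).2) = fieldCoord Γ c z := by
  have h := hΓ.homogeneous _ hz.2
  have : IsManifold (𝓡 n).tangent (minSmoothness ℝ 2) (TangentBundle (𝓡 n) M) :=
    IsManifold.of_le (n := ∞) (by rw [minSmoothness_of_isRCLikeNormedField]; exact ENat.LEInfty.out)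
  have hpull := VectorField.mpullback_mlieBracket (n := ∞) (f := (tangentChart c).symm) (x₀ := z)
    (I := 𝓘(ℝ, Coord n × Coord n)) (I' := (𝓡 n).tangent)
    ((contMDiffAt_liouville ((tangentChart c).symm z)).mdifferentiableAt (by simp))
    ((hΓ.contMDiffAt hz.2).mdifferentiableAt (by simp))
    (contMDiffAt_tangentChart_symm hz.1)
    (by rw [minSmoothness_of_isRCLikeNormedField]; exact ENat.LEInfty.out)
  have h1 : VectorField.mpullback 𝓘(ℝ, Coord n × Coord n) (𝓡 n).tangent (tangentChart c).symm
      (VectorField.mlieBracket (𝓡 n).tangent (liouville : Field n M) Γ) z = fieldCoord Γ c z := by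
    rw [VectorField.mpullback_apply, h]; rfl
  rw [h1] at hpull
  have h2 : (fieldCoord (liouville : Field n M) c) =ᶠ[𝓝 z] liouvilleCoord := by
    filter_upwards [(isOpen_tangentChart_target c).mem_nhds hz.1] with w hw
      using fieldCoord_liouville hw
  have h3 : fieldCoord Γ c z = VectorField.lieBracket ℝ (fieldCoord (liouville : Field n M) c)
      (fieldCoord Γ c) z := by
    refine hpull.trans ?_
    rw [← VectorField.mlieBracketWithin_univ, VectorField.mlieBracketWithin_eq_lieBracketWithin]
    exact congrFun VectorField.lieBracketWithin_univ z
  rw [h2.lieBracket_vectorField_eq EventuallyEq.rfl] at h3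
  conv_rhs => rw [h3]
  rw [VectorField.lieBracket, (hasFDerivAt_liouvilleCoord z).fderiv]
  rfl

/-- Euler's identity for the coefficients of a spray. -/
theorem IsSpray.euler {Γ : Field n M} (hΓ : IsSpray Γ) {c : M} {z : Coord n × Coord n}
    (hz : z ∈ chartDomain c) :
    fderiv ℝ (fun p => (fieldCoord Γ c p).2) z (0, z.2) = (2 : ℝ) • (fieldCoord Γ c z).2 := by
  have h := congrArg Prod.snd (hΓ.lieBracket_fieldCoord hz)
  have hd : DifferentiableAt ℝ (fieldCoord Γ c) z :=
    ((hΓ.contDiffOn_fieldCoord c).contDiffAt ((isOpen_chartDomain c).mem_nhds hz)).differentiableAt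
      (by simp)
  have hs : HasFDerivAt (fun p => (fieldCoord Γ c p).2)
      ((ContinuousLinearMap.snd ℝ (Coord n) (Coord n)).comp (fderiv ℝ (fieldCoord Γ c) z)) z :=
    hasFDerivAt_snd.comp z hd.hasFDerivAt
  rw [hs.fderiv, two_smul]
  simpa [sub_eq_iff_eq_add] using h

theorem fieldCoord_add_smul_liouville {Γ Γ' : Field n M} {c : M} {z : Coord n × Coord n}
    (hz : z ∈ (tangentChart c).target) {k : ℝ}
    (h : Γ' ((tangentChart c).symm z) = Γ ((tangentChart c).symm z) +
      k • liouville ((tangentChart c).symm z)) :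
    fieldCoord Γ' c z = fieldCoord Γ c z + k • liouvilleCoord z := by
  rw [← fieldCoord_liouville hz]
  refine (congrArg (mfderiv 𝓘(ℝ, Coord n × Coord n) (𝓡 n).tangent
    (tangentChart c).symm z).inverse h).trans ?_
  exact (map_add _ _ _).trans (congrArg _ (map_smul _ _ _))

/-- The coefficients of a spray are positively homogeneous of degree two. -/
theorem IsSpray.fieldCoord_smul {Γ : Field n M} (hΓ : IsSpray Γ) {c : M} {z : Coord n × Coord n}
    (hz : z ∈ chartDomain c) {a : ℝ} (ha : 0 < a) :
    fieldCoord Γ c (z.1, a • z.2) = (a • z.2, a ^ 2 • (fieldCoord Γ c z).2) := by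
  have hsm : ContDiffOn ℝ ∞ (fun p => (fieldCoord Γ c p).2) (chartDomain c) :=
    (hΓ.contDiffOn_fieldCoord c).snd
  ext1
  · exact hΓ.fieldCoord_fst (smul_mem_chartDomain hz ha)
  · exact apply_smul_of_euler (g := fun p => (fieldCoord Γ c p).2) 2
      (fun b hb => differentiableAt_of_contDiffOn_chartDomain hsm (smul_mem_chartDomain hz hb))
      (fun b hb => hΓ.euler (smul_mem_chartDomain hz hb)) ha

/-! ### Integral curves in coordinates -/

theorem mfderiv_tangentChart_field (X : Field n M) {c : M} {v : TangentBundle (𝓡 n) M}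
    (hv : v ∈ (tangentChart c).source) :
    mfderiv (𝓡 n).tangent 𝓘(ℝ, Coord n × Coord n) (tangentChart c) v (X v) =
      fieldCoord X c (tangentChart c v) := by
  have ht := (tangentChart c).map_source hv
  have h := mfderiv_tangentChart_comp_symm ht (fieldCoord X c (tangentChart c v))
  rw [mfderiv_symm_fieldCoord X ht, (tangentChart c).left_inv hv] at h
  exact h

theorem hasDerivAt_tangentChart_comp {X : Field n M} {γ : ℝ → TangentBundle (𝓡 n) M} {s : Set ℝ}
    (hs : IsOpen s) (hγ : IsMIntegralCurveOn γ X s) {t : ℝ} (ht : t ∈ s) {c : M}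
    (hc : γ t ∈ (tangentChart c).source) :
    HasDerivAt (fun r => tangentChart c (γ r)) (fieldCoord X c (tangentChart c (γ t))) t := by
  have h1 := (hγ t ht).hasMFDerivAt (hs.mem_nhds ht)
  have h2 := ((contMDiffAt_tangentChart hc).mdifferentiableAt (by simp)).hasMFDerivAt
  refine hasDerivAt_iff_hasFDerivAt.2 ((h2.comp t h1).congr_mfderiv ?_).hasFDerivAt
  refine ContinuousLinearMap.ext fun r => ?_
  rw [← mfderiv_tangentChart_field X hc]
  exact (mfderiv (𝓡 n).tangent 𝓘(ℝ, Coord n × Coord n) (tangentChart c) (γ t)).map_smul r (X (γ t))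

theorem hasMFDerivAt_of_hasDerivAt_fieldCoord {X : Field n M} {c : M} {f : ℝ → Coord n × Coord n}
    {t : ℝ} (hz : f t ∈ (tangentChart c).target) (hf : HasDerivAt f (fieldCoord X c (f t)) t) :
    HasMFDerivAt 𝓘(ℝ, ℝ) (𝓡 n).tangent (fun r => (tangentChart c).symm (f r)) t
      ((1 : ℝ →L[ℝ] ℝ).smulRight (X ((tangentChart c).symm (f t)))) := by
  have h := hasMFDerivAt_tangentChart_symm_comp hz rfl hf
  rw [mfderiv_symm_fieldCoord X hz] at h
  exact h

theorem IsSpray.exists_isMIntegralCurveOn {Γ : Field n M} (hΓ : IsSpray Γ)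
    {v : TangentBundle (𝓡 n) M} (hv : v ∈ slit n M) :
    ∃ (γ : ℝ → TangentBundle (𝓡 n) M) (s : Set ℝ), IsOpenInterval s ∧ (0 : ℝ) ∈ s ∧ γ 0 = v ∧
      IsMIntegralCurveOn γ Γ s ∧ ∀ t ∈ s, γ t ∈ slit n M := by
  obtain ⟨γ, h0, hγ⟩ := exists_isMIntegralCurveAt_of_contMDiffAt_boundaryless 0
    ((hΓ.contMDiffAt hv).of_le (m := 1) ENat.LEInfty.out)
  obtain ⟨ε, hε, hγε⟩ := isMIntegralCurveAt_iff'.1 hγ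
  have hev : ∀ᶠ t in 𝓝 (0 : ℝ), γ t ∈ slit n M :=
    hγ.continuousAt.preimage_mem_nhds (isOpen_slit.mem_nhds (h0 ▸ hv))
  obtain ⟨δ, hδ, hball⟩ := Metric.eventually_nhds_iff_ball.1 hev
  refine ⟨γ, Metric.ball 0 (min ε δ), ⟨Metric.isOpen_ball, ?_⟩, ?_, h0, ?_, ?_⟩
  · rw [Real.ball_eq_Ioo]; exact ordConnected_Ioo
  · exact Metric.mem_ball_self (lt_min hε hδ)
  · exact hγε.mono (Metric.ball_subset_ball (min_le_left _ _))
  · exact fun t ht => hball t (Metric.ball_subset_ball (min_le_right _ _) ht)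

/-! ### Functions and forms on the tangent bundle in coordinates -/

theorem homogeneous_iff_funCoord {F : TangentBundle (𝓡 n) M → ℝ} :
    (∀ v ∈ slit n M, ∀ a : ℝ, 0 < a → F ⟨v.proj, a • v.snd⟩ = a * F v) ↔
      ∀ c : M, ∀ z ∈ chartDomain c, ∀ a : ℝ, 0 < a →
        funCoord F c (z.1, a • z.2) = a * funCoord F c z := by
  constructor
  · intro h c z hz a ha
    rw [funCoord, tangentChart_symm_smul hz.1]
    exact h _ hz.2 a ha
  · intro h v hv a ha
    have hs := mem_tangentChart_source_self v
    have h1 := h v.proj _ (tangentChart_mem_chartDomain hs hv) a ha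
    rwa [funCoord, funCoord, tangentChart_symm_smul ((tangentChart _).map_source hs),
      (tangentChart _).left_inv hs] at h1

theorem contMDiffOn_slit_iff {F : TangentBundle (𝓡 n) M → ℝ} :
    ContMDiffOn (𝓡 n).tangent 𝓘(ℝ, ℝ) ∞ F (slit n M) ↔
      ∀ c : M, ContDiffOn ℝ ∞ (funCoord F c) (chartDomain c) := by
  constructor
  · intro h c z hz
    have h1 : ContMDiffAt 𝓘(ℝ, Coord n × Coord n) 𝓘(ℝ, ℝ) ∞ (F ∘ (tangentChart c).symm) z :=
      ((h _ hz.2).contMDiffAt (isOpen_slit.mem_nhds hz.2)).comp z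
        (contMDiffAt_tangentChart_symm hz.1)
    exact h1.contDiffAt.contDiffWithinAt
  · intro h v hv
    have hs := mem_tangentChart_source_self v
    have hz := tangentChart_mem_chartDomain hs hv
    have h1 : ContMDiffAt (𝓡 n).tangent 𝓘(ℝ, ℝ) ∞ (funCoord F v.proj ∘ tangentChart v.proj) v :=
      (((h v.proj).contDiffAt ((isOpen_chartDomain _).mem_nhds hz)).contMDiffAt).comp v
        (contMDiffAt_tangentChart hs)
    refine (h1.congr_of_eventuallyEq ?_).contMDiffWithinAt
    filter_upwards [(isOpen_tangentChart_source _).mem_nhds hs] with w hw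
    simp [funCoord, (tangentChart v.proj).left_inv hw]

/-- The semi-basic form `d_J F = (∂F/∂yⁱ) dxⁱ`, defined without charts: at `v` it is the derivative of
`F` along the fibre through `v`, composed with the differential of the projection. -/
def fiberDifferential (F : TangentBundle (𝓡 n) M → ℝ) : OneForm n M := fun v =>
  (fderiv ℝ (fun w : Coord n => F ⟨v.proj, w⟩) v.snd : Coord n →L[ℝ] ℝ).comp
    (mfderiv (𝓡 n).tangent (𝓡 n) (Bundle.TotalSpace.proj : TangentBundle (𝓡 n) M → M) v :
      (Coord n × Coord n) →L[ℝ] Coord n)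

theorem isSemiBasic_fiberDifferential (F : TangentBundle (𝓡 n) M → ℝ) :
    IsSemiBasic (fiberDifferential F) := by
  intro v _ ξ hξ
  refine (congrArg (fderiv ℝ (fun w : Coord n => F ⟨v.proj, w⟩) v.snd : Coord n →L[ℝ] ℝ)
    hξ).trans ?_
  exact map_zero (fderiv ℝ (fun w : Coord n => F ⟨v.proj, w⟩) v.snd : Coord n →L[ℝ] ℝ)

theorem formCoord_fiberDifferential {F : TangentBundle (𝓡 n) M → ℝ} {c : M}
    {z : Coord n × Coord n} (hz : z ∈ (tangentChart c).target)
    (hF : DifferentiableAt ℝ (funCoord F c) z) :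
    formCoord (fiberDifferential F) c z =
      (vertDeriv (funCoord F c) z).comp (ContinuousLinearMap.fst ℝ (Coord n) (Coord n)) := by
  have hz' := mem_tangentChart_target.1 hz
  let p := (extChartAt (𝓡 n) c).symm z.1
  let B : Coord n ≃L[ℝ] Coord n := fiberEquiv c p ((extChartAt (𝓡 n) c).map_target hz')
  have hsymm : ∀ y : Coord n, (tangentChart c).symm (z.1, y) =
      (⟨p, B y⟩ : TangentBundle (𝓡 n) M) := fun y => tangentChart_symm_apply (z := (z.1, y)) hz'
  refine ContinuousLinearMap.ext fun u => ?_
  have h1 : formCoord (fiberDifferential F) c z u =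
      (fderiv ℝ (fun w : Coord n => F ⟨p, w⟩) (B z.2)) (B u.1) := by
    have := mfderiv_proj_symm hz u
    have h3 : formCoord (fiberDifferential F) c z u =
      (fderiv ℝ (fun w : Coord n => F ⟨((tangentChart c).symm z).proj, w⟩)
        ((tangentChart c).symm z).snd : Coord n →L[ℝ] ℝ) (B u.1) :=
      congrArg (fderiv ℝ (fun w : Coord n => F ⟨((tangentChart c).symm z).proj, w⟩)
        ((tangentChart c).symm z).snd : Coord n →L[ℝ] ℝ) this
    rw [h3]
    have h4 := hsymm z.2
    rw [Prod.mk.eta] at h4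
    rw [h4]
  have h2 : (fun y => funCoord F c (z.1, y)) = (fun w : Coord n => F ⟨p, w⟩) ∘ B := by
    funext y; simp only [funCoord, hsymm, Function.comp_apply]
  have h5 : HasFDerivAt (fun y => funCoord F c (z.1, y)) (vertDeriv (funCoord F c) z) z.2 :=
    HasFDerivAt.comp (g := funCoord F c) z.2 hF.hasFDerivAt (hasFDerivAt_prodMk_right z.1 z.2)
  rw [h1, ContinuousLinearMap.comp_apply, ← h5.fderiv, h2, B.comp_right_fderiv]
  rfl

/-- A semi-basic form has no `dyⁱ` components. -/
theorem IsSemiBasic.formCoord_apply {θ : OneForm n M} (hθ : IsSemiBasic θ) {c : M}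
    {z : Coord n × Coord n} (hz : z ∈ chartDomain c) (u : Coord n × Coord n) :
    formCoord θ c z u = formCoord θ c z (u.1, 0) := by
  have h : formCoord θ c z (u - (u.1, 0)) = 0 := by
    refine hθ _ hz.2 _ ?_
    refine (mfderiv_proj_symm hz.1 (u - (u.1, 0))).trans ?_
    rw [Prod.fst_sub, sub_self]
    exact map_zero (fiberEquiv c _ _)
  rw [map_sub] at h
  exact sub_eq_zero.1 h

theorem funCoord_contraction (θ : OneForm n M) (X : Field n M) {c : M} {z : Coord n × Coord n}
    (hz : z ∈ (tangentChart c).target) :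
    funCoord (fun v => θ v (X v)) c z = formCoord θ c z (fieldCoord X c z) := by
  exact congrArg (θ ((tangentChart c).symm z)) (mfderiv_symm_fieldCoord X hz).symm

/-! ### Geodesics and the Euler-Lagrange equations -/

section Lifts

variable {Γ : Field n M} {γ : ℝ → TangentBundle (𝓡 n) M} {σ : ℝ → M} {s : Set ℝ} {c : M} {t : ℝ}

/-- The velocity of a geodesic is the integral curve it lifts to. -/
theorem IsSpray.hasDerivAt_base (hΓ : IsSpray Γ) (hs : IsOpen s) (hγ : IsMIntegralCurveOn γ Γ s)
    (hσ : ∀ t ∈ s, γ t ∈ slit n M ∧ (γ t).proj = σ t) (ht : t ∈ s)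
    (hc : γ t ∈ (tangentChart c).source) :
    HasDerivAt (fun r => extChartAt (𝓡 n) c (σ r)) (tangentChart c (γ t)).2 t := by
  have h := hasDerivAt_tangentChart_comp hs hγ ht hc
  have h1 : HasDerivAt (fun r => (tangentChart c (γ r)).1)
      (fieldCoord Γ c (tangentChart c (γ t))).1 t := by
    have h0 : HasFDerivAt Prod.fst (ContinuousLinearMap.fst ℝ (Coord n) (Coord n))
      (tangentChart c (γ t)) := hasFDerivAt_fst
    exact h0.comp_hasDerivAt t h
  rw [hΓ.fieldCoord_fst (tangentChart_mem_chartDomain hc (hσ t ht).1)] at h1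
  refine h1.congr_of_eventuallyEq ?_
  filter_upwards [hs.mem_nhds ht] with r hr
  rw [← (hσ r hr).2]
  rfl

theorem eventually_mem_tangentChart_source (hs : IsOpen s) (hγ : IsMIntegralCurveOn γ Γ s)
    (ht : t ∈ s) (hc : γ t ∈ (tangentChart c).source) :
    ∀ᶠ r in 𝓝 t, r ∈ s ∧ γ r ∈ (tangentChart c).source :=
  Filter.Eventually.and (hs.mem_nhds ht)
    (((hγ t ht).1.continuousAt (hs.mem_nhds ht)).preimage_mem_nhds
      ((isOpen_tangentChart_source c).mem_nhds hc))

theorem IsSpray.eventually_coordinates (hΓ : IsSpray Γ) (hs : IsOpen s)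
    (hγ : IsMIntegralCurveOn γ Γ s) (hσ : ∀ t ∈ s, γ t ∈ slit n M ∧ (γ t).proj = σ t) (ht : t ∈ s)
    (hc : γ t ∈ (tangentChart c).source) :
    ∀ᶠ r in 𝓝 t, (extChartAt (𝓡 n) c (σ r), deriv (fun r => extChartAt (𝓡 n) c (σ r)) r) =
      tangentChart c (γ r) := by
  filter_upwards [eventually_mem_tangentChart_source hs hγ ht hc] with r hr
  rw [(hΓ.hasDerivAt_base hs hγ hσ hr.1 hr.2).deriv, ← (hσ r hr.1).2]
  rfl

theorem hasDerivAt_vertDeriv_comp {F : TangentBundle (𝓡 n) M → ℝ}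
    (hF : ContDiffOn ℝ ∞ (funCoord F c) (chartDomain c)) (hs : IsOpen s)
    (hγ : IsMIntegralCurveOn γ Γ s) (hslit : γ t ∈ slit n M) (ht : t ∈ s)
    (hc : γ t ∈ (tangentChart c).source) :
    HasDerivAt (fun r => vertDeriv (funCoord F c) (tangentChart c (γ r)))
      (fderiv ℝ (vertDeriv (funCoord F c)) (tangentChart c (γ t))
        (fieldCoord Γ c (tangentChart c (γ t)))) t := by
  have hd : DifferentiableAt ℝ (vertDeriv (funCoord F c)) (tangentChart c (γ t)) :=
    ((contDiffOn_vertDeriv (isOpen_chartDomain c) hF).contDiffAt ((isOpen_chartDomain c).mem_nhds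
      (tangentChart_mem_chartDomain hc hslit))).differentiableAt (by simp)
  exact hd.hasFDerivAt.comp_hasDerivAt t (hasDerivAt_tangentChart_comp hs hγ ht hc)

theorem IsSpray.hasDerivAt_of_solvesEulerLagrange {F : TangentBundle (𝓡 n) M → ℝ}
    (hΓ : IsSpray Γ) (hs : IsOpen s) (hγ : IsMIntegralCurveOn γ Γ s)
    (hσ : ∀ t ∈ s, γ t ∈ slit n M ∧ (γ t).proj = σ t) (hEL : SolvesEulerLagrange F σ s)
    (ht : t ∈ s) (hc : γ t ∈ (tangentChart c).source) :
    HasDerivAt (fun r => vertDeriv (funCoord F c) (tangentChart c (γ r)))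
      (baseDeriv (funCoord F c) (tangentChart c (γ t))) t := by
  have hev := hΓ.eventually_coordinates hs hγ hσ ht hc
  have h := hEL c t ht (by rw [← (hσ t ht).2]; exact mem_tangentChart_source.1 hc)
  simp only [hev.self_of_nhds] at h
  refine h.congr_of_eventuallyEq ?_
  filter_upwards [hev] with r hr
  rw [hr]

theorem IsSpray.solvesEulerLagrange {F : TangentBundle (𝓡 n) M → ℝ}
    (hF : ∀ c, ContDiffOn ℝ ∞ (funCoord F c) (chartDomain c))
    (hΓ : IsSpray Γ) (hEL : ∀ c, ∀ z ∈ chartDomain c,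
      EulerLagrangeAt (funCoord F c) (fieldCoord Γ c) z)
    (hσ : IsGeodesicOn Γ σ s) : SolvesEulerLagrange F σ s := by
  obtain ⟨hs, γ, hγ, hσ⟩ := hσ
  intro c t ht hc x
  rw [← (hσ t ht).2] at hc
  replace hc := mem_tangentChart_source.2 hc
  have hev := hΓ.eventually_coordinates hs.1 hγ hσ ht hc
  have h := hasDerivAt_vertDeriv_comp (hF c) hs.1 hγ (hσ t ht).1 ht hc
  rw [hEL c _ (tangentChart_mem_chartDomain hc (hσ t ht).1)] at h
  rw [hev.self_of_nhds]
  refine h.congr_of_eventuallyEq ?_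
  filter_upwards [hev] with r hr
  rw [hr]

/-- A spray lies in the geodesic class of `F` exactly when `Γ (∂F/∂yⁱ) = ∂F/∂xⁱ` on `T°M`, because
there is a geodesic with any given nonzero initial velocity. -/
theorem mem_geodesicClass_iff {F : TangentBundle (𝓡 n) M → ℝ}
    (hF : ∀ c, ContDiffOn ℝ ∞ (funCoord F c) (chartDomain c)) :
    Γ ∈ geodesicClass F ↔ IsSpray Γ ∧ ∀ c, ∀ z ∈ chartDomain c,
      EulerLagrangeAt (funCoord F c) (fieldCoord Γ c) z := by
  refine and_congr_right fun hΓ => ⟨fun h c z hz => ?_, fun h σ s hσ =>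
    hΓ.solvesEulerLagrange hF h hσ⟩
  obtain ⟨γ, s, hs, h0, hγ0, hγ, hslit⟩ := hΓ.exists_isMIntegralCurveOn hz.2
  have hσ : ∀ t ∈ s, γ t ∈ slit n M ∧ (γ t).proj = (γ t).proj := fun t ht => ⟨hslit t ht, rfl⟩
  have hc : γ 0 ∈ (tangentChart c).source := hγ0 ▸ (tangentChart c).map_target hz.1
  have h1 := hΓ.hasDerivAt_of_solvesEulerLagrange hs.1 hγ hσ (h _ s ⟨hs, γ, hγ, hσ⟩) h0 hc
  have h2 := (hasDerivAt_vertDeriv_comp (hF c) hs.1 hγ (hslit 0 h0) h0 hc).unique h1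
  rwa [hγ0, (tangentChart c).right_inv hz.1] at h2

end Lifts

/-! ### The geodesic class of a pseudo-Finsler function -/

section PseudoFinsler

variable {F : TangentBundle (𝓡 n) M → ℝ} {c : M} {z : Coord n × Coord n}

theorem IsPseudoFinsler.contDiffOn (hF : IsPseudoFinsler F) (c : M) :
    ContDiffOn ℝ ∞ (funCoord F c) (chartDomain c) := contMDiffOn_slit_iff.1 hF.smooth c

theorem IsPseudoFinsler.euler (hF : IsPseudoFinsler F) (hz : z ∈ chartDomain c) :
    vertDeriv (funCoord F c) z z.2 = funCoord F c z :=
  vertDeriv_self_of_homogeneous (differentiableAt_of_contDiffOn_chartDomain (hF.contDiffOn c) hz)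
    (homogeneous_iff_funCoord.1 hF.homogeneous c z hz)

theorem IsPseudoFinsler.hessian_self (hF : IsPseudoFinsler F) (hz : z ∈ chartDomain c) :
    hessian F c z z.2 = 0 :=
  vertDeriv_vertDeriv_self (isOpen_chartDomain c) (hF.contDiffOn c) (fun _ hp => hF.euler hp) hz

theorem IsPseudoFinsler.vertDeriv_smul (hF : IsPseudoFinsler F) (hz : z ∈ chartDomain c) {a : ℝ}
    (ha : 0 < a) :
    vertDeriv (funCoord F c) (z.1, a • z.2) = vertDeriv (funCoord F c) z := by
  have h := apply_smul_of_euler (g := vertDeriv (funCoord F c)) (x := z.1) (y := z.2) 0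
    (fun b hb => differentiableAt_of_contDiffOn_chartDomain
      (contDiffOn_vertDeriv (isOpen_chartDomain c) (hF.contDiffOn c)) (smul_mem_chartDomain hz hb))
    (fun b hb => by
      rw [Nat.cast_zero, zero_smul]
      exact hF.hessian_self (smul_mem_chartDomain hz hb)) ha
  simpa using h

theorem IsPseudoFinsler.baseDeriv_smul (hF : IsPseudoFinsler F) (hz : z ∈ chartDomain c) {a : ℝ}
    (ha : 0 < a) :
    baseDeriv (funCoord F c) (z.1, a • z.2) = a • baseDeriv (funCoord F c) z := by
  refine baseDeriv_smul_of_homogeneous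
    (differentiableAt_of_contDiffOn_chartDomain (hF.contDiffOn c) hz)
    (differentiableAt_of_contDiffOn_chartDomain (hF.contDiffOn c) (smul_mem_chartDomain hz ha)) ?_
  have hcont : Tendsto (fun x' => (x', z.2)) (𝓝 z.1) (𝓝 z) :=
    (Continuous.prodMk_left z.2).tendsto z.1
  filter_upwards [hcont ((isOpen_chartDomain c).mem_nhds hz)] with x' hx'
    using homogeneous_iff_funCoord.1 hF.homogeneous c (x', z.2) hx' a ha

/-- If the geodesics of `Γ'` are reparametrized geodesics of `Γ`, they solve the Euler-Lagrange
equations along with those of `Γ`: `∂F/∂yⁱ` and `∂F/∂xⁱ` are positively homogeneous of degree zero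
and one, which makes the equations invariant under reparametrization. -/
theorem IsPseudoFinsler.eulerLagrangeAt_of_reparametrize (hF : IsPseudoFinsler F) {Γ Γ' : Field n M}
    (hΓ : Γ ∈ geodesicClass F) (hΓ' : IsSpray Γ') (hrep : GeodesicsReparametrize Γ' Γ)
    (hz : z ∈ chartDomain c) : EulerLagrangeAt (funCoord F c) (fieldCoord Γ' c) z := by
  obtain ⟨γ', s, hs, h0, hγ0, hγ', hslit⟩ := hΓ'.exists_isMIntegralCurveOn hz.2
  have hσ' : ∀ t ∈ s, γ' t ∈ slit n M ∧ (γ' t).proj = (γ' t).proj := fun t ht => ⟨hslit t ht, rfl⟩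
  have hc' : γ' 0 ∈ (tangentChart c).source := hγ0 ▸ (tangentChart c).map_target hz.1
  obtain ⟨φ, s', hφ, hφd, hgeo⟩ := hrep (fun t => (γ' t).proj) s ⟨hs, γ', hγ', hσ'⟩
  have hEL := hΓ.2 _ _ hgeo
  obtain ⟨hs', γ, hγ, hσ⟩ := hgeo
  obtain ⟨r₀, hr₀, hφ0⟩ := hφ.surjOn h0
  have hc : γ r₀ ∈ (tangentChart c).source := by
    rw [mem_tangentChart_source, (hσ r₀ hr₀).2, Function.comp_apply, hφ0]
    exact mem_tangentChart_source.1 hc'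
  obtain ⟨a, ha, hφa⟩ := hφd r₀ hr₀
  -- in coordinates the lift of `σ ∘ φ` is `(x, φ' y)` at `φ r` if the lift of `σ` is `(x, y)`
  have hcoord : ∀ r ∈ s', γ' (φ r) ∈ (tangentChart c).source → γ r ∈ (tangentChart c).source →
      ∀ b, HasDerivAt φ b r → tangentChart c (γ r) =
        ((tangentChart c (γ' (φ r))).1, b • (tangentChart c (γ' (φ r))).2) := by
    intro r hr hr1 hr2 b hb
    have h1 := hΓ'.hasDerivAt_base hs.1 hγ' hσ' (hφ.mapsTo hr) hr1
    have h2 := hΓ.1.hasDerivAt_base hs'.1 hγ hσ hr hr2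
    have h3 := h2.unique (h1.scomp r hb)
    refine Prod.ext ?_ h3
    exact congrArg (extChartAt (𝓡 n) c) (hσ r hr).2
  have hev : ∀ᶠ r in 𝓝 r₀, (r ∈ s' ∧ γ r ∈ (tangentChart c).source) ∧
      γ' (φ r) ∈ (tangentChart c).source := by
    refine (eventually_mem_tangentChart_source hs'.1 hγ hr₀ hc).and ?_
    have h1 := eventually_mem_tangentChart_source hs.1 hγ' h0 hc'
    rw [← hφ0] at h1
    exact (hφa.continuousAt.eventually h1).mono fun r hr => hr.2
  have h1 := hΓ.1.hasDerivAt_of_solvesEulerLagrange hs'.1 hγ hσ hEL hr₀ hc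
  have h2 := hasDerivAt_vertDeriv_comp (hF.contDiffOn c) hs.1 hγ' (hslit 0 h0) h0 hc'
  rw [← hφ0] at h2
  have h3 := h2.scomp r₀ hφa
  have h4 : (fun r => vertDeriv (funCoord F c) (tangentChart c (γ r))) =ᶠ[𝓝 r₀]
      (fun r => vertDeriv (funCoord F c) (tangentChart c (γ' r))) ∘ φ := by
    filter_upwards [hev] with r hr
    obtain ⟨b, hb, hφb⟩ := hφd r hr.1.1
    rw [hcoord r hr.1.1 hr.2 hr.1.2 b hφb, Function.comp_apply, hF.vertDeriv_smul
      (tangentChart_mem_chartDomain hr.2 (hslit _ (hφ.mapsTo hr.1.1))) hb]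
  have h5 := (h3.congr_of_eventuallyEq h4).unique h1
  rw [hcoord r₀ hr₀ (hφ0.symm ▸ hc') hc a hφa, hφ0, hγ0, (tangentChart c).right_inv hz.1,
    hF.baseDeriv_smul hz ha] at h5
  exact smul_right_injective _ ha.ne' h5

/-- Quasi-regularity of the Hessian: two sprays satisfying the Euler-Lagrange equations of `F`
differ by a multiple of the Liouville field. -/
theorem IsPseudoFinsler.exists_sub_eq_smul_liouville (hF : IsPseudoFinsler F) {Γ Γ' : Field n M}
    (hΓ : Γ ∈ geodesicClass F) (hΓ' : Γ' ∈ geodesicClass F) {v : TangentBundle (𝓡 n) M}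
    (hv : v ∈ slit n M) : ∃ k : ℝ, Γ' v = Γ v + k • liouville v := by
  have hs := mem_tangentChart_source_self v
  have hz := tangentChart_mem_chartDomain hs hv
  have ht := (tangentChart v.proj).map_source hs
  have hEL := ((mem_geodesicClass_iff hF.contDiffOn).1 hΓ).2 _ _ hz
  have hEL' := ((mem_geodesicClass_iff hF.contDiffOn).1 hΓ').2 _ _ hz
  set z := tangentChart v.proj v
  have hd : fieldCoord Γ' v.proj z - fieldCoord Γ v.proj z =
      (0, (fieldCoord Γ' v.proj z).2 - (fieldCoord Γ v.proj z).2) := by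
    ext1
    · simp [hΓ.1.fieldCoord_fst hz, hΓ'.1.fieldCoord_fst hz]
    · rfl
  have h1 : hessian F v.proj z ((fieldCoord Γ' v.proj z).2 - (fieldCoord Γ v.proj z).2) = 0 := by
    rw [hessian, vertDeriv, ContinuousLinearMap.comp_apply, ContinuousLinearMap.inr_apply, ← hd,
      map_sub, sub_eq_zero]
    exact hEL'.trans hEL.symm
  obtain ⟨k, hk⟩ := (hF.quasiRegular v.proj z hz
    ((fieldCoord Γ' v.proj z).2 - (fieldCoord Γ v.proj z).2)).1 fun u => by
      rw [hessian, vertDeriv_vertDeriv_symm (isOpen_chartDomain _) (hF.contDiffOn _) hz]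
      exact congrArg (fun L : Coord n →L[ℝ] ℝ => L u) h1
  have h2 : fieldCoord Γ' v.proj z = fieldCoord Γ v.proj z + k • liouvilleCoord z := by
    rw [← sub_eq_iff_eq_add', hd, hk]
    simp [liouvilleCoord]
  have h3 := congrArg (mfderiv 𝓘(ℝ, Coord n × Coord n) (𝓡 n).tangent
    (tangentChart v.proj).symm z) h2
  rw [mfderiv_symm_fieldCoord Γ' ht] at h3
  have h4 : mfderiv 𝓘(ℝ, Coord n × Coord n) (𝓡 n).tangent (tangentChart v.proj).symm z
      (fieldCoord Γ v.proj z + k • liouvilleCoord z) = Γ ((tangentChart v.proj).symm z) +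
        k • liouville ((tangentChart v.proj).symm z) := by
    rw [← fieldCoord_liouville ht, ← mfderiv_symm_fieldCoord Γ ht,
      ← mfderiv_symm_fieldCoord liouville ht]
    exact (map_add _ (fieldCoord Γ v.proj z) (k • fieldCoord liouville v.proj z)).trans
      (congrArg _ (map_smul _ k (fieldCoord (liouville : Field n M) v.proj z)))
  have h5 := h3.trans h4
  rw [(tangentChart v.proj).left_inv hs] at h5
  exact ⟨k, h5⟩

end PseudoFinsler

/-- Sprays `Γ' = Γ + P Δ` have the same geodesics: along a geodesic of `Γ` the new parameter is
found by solving `φ'' = P φ'²`. -/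
theorem IsSpray.geodesicsReparametrize {Γ Γ' : Field n M} (hΓ : IsSpray Γ) (hΓ' : IsSpray Γ')
    {P : TangentBundle (𝓡 n) M → ℝ} (hP : ∀ v ∈ slit n M, Γ' v = Γ v + P v • liouville v) :
    GeodesicsReparametrize Γ Γ' := by
  rintro σ s ⟨hs, γ, hγ, hσ⟩
  have hcoord : ∀ c : M, ∀ v ∈ slit n M, v ∈ (tangentChart c).source →
      fieldCoord Γ' c (tangentChart c v) = fieldCoord Γ c (tangentChart c v) +
        P v • liouvilleCoord (tangentChart c v) := by
    intro c v hv hvc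
    refine fieldCoord_add_smul_liouville ((tangentChart c).map_source hvc) ?_
    rw [(tangentChart c).left_inv hvc]
    exact hP v hv
  have hcont : ContinuousOn (fun t => P (γ t)) s := by
    intro t ht
    have hc := mem_tangentChart_source_self (γ t)
    set c := (γ t).proj
    have hz := tangentChart_mem_chartDomain hc (hσ t ht).1
    have hX : ∀ {Δ : Field n M}, IsSpray Δ → ContinuousAt (fun z => (fieldCoord Δ c z).2)
        (tangentChart c (γ t)) := fun hΔ =>
      (differentiableAt_of_contDiffOn_chartDomain (hΔ.contDiffOn_fieldCoord c).snd hz).continuousAt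
    have hzc : ContinuousAt (fun r => tangentChart c (γ r)) t :=
      (hasDerivAt_tangentChart_comp hs.1 hγ ht hc).continuousAt
    -- `P` is read off from the component of the difference of the sprays along `y`
    have h1 : ContinuousAt (fun r => inner ℝ (tangentChart c (γ r)).2
        ((fieldCoord Γ' c (tangentChart c (γ r))).2 - (fieldCoord Γ c (tangentChart c (γ r))).2) /
          inner ℝ (tangentChart c (γ r)).2 (tangentChart c (γ r)).2) t := by
      refine ContinuousAt.div (ContinuousAt.inner hzc.snd ?_) (hzc.snd.inner hzc.snd) ?_
      · exact (ContinuousAt.comp (f := fun r => tangentChart c (γ r))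
            (g := fun z => (fieldCoord Γ' c z).2) (hX hΓ') hzc).sub
          (ContinuousAt.comp (f := fun r => tangentChart c (γ r))
            (g := fun z => (fieldCoord Γ c z).2) (hX hΓ) hzc)
      · exact inner_self_ne_zero.2 (mem_chartDomain.1 hz).2
    refine (h1.congr ?_).continuousWithinAt
    filter_upwards [eventually_mem_tangentChart_source hs.1 hγ ht hc] with r hr
    have hzr := tangentChart_mem_chartDomain hr.2 (hσ r hr.1).1
    rw [hcoord c (γ r) (hσ r hr.1).1 hr.2]
    simp only [Prod.snd_add, Prod.smul_snd, liouvilleCoord, add_sub_cancel_left, inner_smul_right]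
    exact mul_div_cancel_right₀ _ (inner_self_ne_zero.2 (mem_chartDomain.1 hzr).2)
  obtain ⟨φ, g, s', hs', hφ, hode⟩ := exists_reparametrization hs hcont
  refine ⟨φ, s', hφ, fun r hr => ⟨g r, (hode r hr).1, (hode r hr).2.1⟩, hs',
    fun r => ⟨(γ (φ r)).proj, g r • (γ (φ r)).snd⟩, ?_, fun r hr => ⟨?_, ?_⟩⟩
  · intro r hr
    obtain ⟨hg, hφ', hg'⟩ := hode r hr
    have hφs := hφ.mapsTo hr
    have hc := mem_tangentChart_source_self (γ (φ r))
    set c := (γ (φ r)).proj with hcdef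
    have hz := tangentChart_mem_chartDomain hc (hσ _ hφs).1
    have hzd := (hasDerivAt_tangentChart_comp hs.1 hγ hφs hc).scomp r hφ'
    have hz1 := (hasFDerivAt_fst (𝕜 := ℝ) (p := tangentChart c (γ (φ r)))).comp_hasDerivAt r hzd
    have hz2 := (hasFDerivAt_snd (𝕜 := ℝ) (p := tangentChart c (γ (φ r)))).comp_hasDerivAt r hzd
    have hw := hz1.prodMk (hg'.smul hz2)
    set w : ℝ → Coord n × Coord n := fun r =>
      ((tangentChart c (γ (φ r))).1, g r • (tangentChart c (γ (φ r))).2) with hwdef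
    have hwd : HasDerivAt w (fieldCoord Γ' c (w r)) r := by
      refine HasDerivAt.congr_deriv (f' := _) hw ?_
      rw [hwdef, hΓ'.fieldCoord_smul hz hg, hcoord c _ (hσ _ hφs).1 hc]
      ext1
      · simp [hΓ.fieldCoord_fst hz]
      · simp [liouvilleCoord, smul_add, smul_smul, pow_two]
    have hwt : w r ∈ (tangentChart c).target := (smul_mem_chartDomain hz hg).1
    have hmf := hasMFDerivAt_of_hasDerivAt_fieldCoord hwt hwd
    have heq : ∀ x, γ (φ x) ∈ (tangentChart c).source → (tangentChart c).symm (w x) =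
        (⟨(γ (φ x)).proj, g x • (γ (φ x)).snd⟩ : TangentBundle (𝓡 n) M) := by
      intro x hx
      rw [hwdef]
      dsimp only
      rw [tangentChart_symm_smul ((tangentChart c).map_source hx), (tangentChart c).left_inv hx]
    rw [heq r hc] at hmf
    refine (hmf.congr_of_eventuallyEq ?_).hasMFDerivWithinAt
    have h1 := eventually_mem_tangentChart_source hs.1 hγ hφs hc
    filter_upwards [hφ'.continuousAt.eventually h1] with x hx using (heq x hx.2).symm
  · exact smul_ne_zero (hode r hr).1.ne' (hσ _ (hφ.mapsTo hr)).1
  · exact (hσ _ (hφ.mapsTo hr)).2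

theorem geodesicsReparametrize_refl (Γ : Field n M) : GeodesicsReparametrize Γ Γ :=
  fun _ s hσ => ⟨id, s, bijOn_id s, fun r _ => ⟨1, one_pos, hasDerivAt_id r⟩, hσ⟩

/-- The geodesic class of a pseudo-Finsler function is the projective class of any of its
members. -/
theorem IsPseudoFinsler.geodesicClass_eq_projectiveClass {F : TangentBundle (𝓡 n) M → ℝ}
    (hF : IsPseudoFinsler F) {Γ : Field n M} (hΓ : Γ ∈ geodesicClass F) :
    geodesicClass F = projectiveClass Γ := by
  ext Γ'
  constructor
  · intro hΓ'
    have h : ∀ {Γ₁ Γ₂ : Field n M}, Γ₁ ∈ geodesicClass F → Γ₂ ∈ geodesicClass F →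
        GeodesicsReparametrize Γ₁ Γ₂ := by
      intro Γ₁ Γ₂ h₁ h₂
      choose! P hP using fun v hv => hF.exists_sub_eq_smul_liouville h₁ h₂ (v := v) hv
      exact h₁.1.geodesicsReparametrize h₂.1 hP
    exact ⟨hΓ'.1, h hΓ hΓ', h hΓ' hΓ⟩
  · rintro ⟨hΓ', -, hrep⟩
    exact (mem_geodesicClass_iff hF.contDiffOn).2 ⟨hΓ', fun c z hz =>
      hF.eulerLagrangeAt_of_reparametrize hΓ hΓ' hrep hz⟩

/-! ### The differential conditions and the rank in coordinates -/

/-- The components `θ_i` of a semi-basic form `θ = θ_i dxⁱ` in the coordinates `tangentChart c`. -/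
def semiBasicCoord (θ : OneForm n M) (c : M) (z : Coord n × Coord n) : Coord n →L[ℝ] ℝ :=
  (formCoord θ c z).comp (ContinuousLinearMap.inl ℝ (Coord n) (Coord n))

theorem multiplier_eq (θ : OneForm n M) (c : M) (z : Coord n × Coord n) :
    multiplier θ c z = vertDeriv (semiBasicCoord θ c) z := rfl

section Conditions

variable {Γ : Field n M} {θ : OneForm n M} {c : M} {z : Coord n × Coord n}

theorem IsSmoothForm.contDiffOn_semiBasicCoord (hθ : IsSmoothForm θ) (c : M) :
    ContDiffOn ℝ ∞ (semiBasicCoord θ c) (chartDomain c) :=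
  (hθ c).clm_comp contDiffOn_const

theorem IsSemiBasic.formCoord_eq (hθ : IsSemiBasic θ) (hz : z ∈ chartDomain c) :
    formCoord θ c z =
      (semiBasicCoord θ c z).comp (ContinuousLinearMap.fst ℝ (Coord n) (Coord n)) :=
  ContinuousLinearMap.ext fun u => hθ.formCoord_apply hz u

/-- The three differential conditions in terms of the components `β = (θ_i)`: these are
homogeneous of degree zero, `V_i θ_j` is symmetric, and `H_i θ_j` is symmetric. -/
theorem differentialConditions_iff {β : M → Coord n × Coord n → Coord n →L[ℝ] ℝ}
    (hβ : ∀ c, ContDiffOn ℝ ∞ (β c) (chartDomain c))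
    (hθ : ∀ c, ∀ z ∈ chartDomain c, formCoord θ c z =
      (β c z).comp (ContinuousLinearMap.fst ℝ (Coord n) (Coord n))) :
    DifferentialConditions Γ θ ↔ ∀ c, ∀ z ∈ chartDomain c,
      vertDeriv (β c) z z.2 = 0 ∧
      (∀ u w, vertDeriv (β c) z u w = vertDeriv (β c) z w u) ∧
      ∀ u w : Coord n × Coord n,
        fderiv ℝ (β c) z (horizontalProjector (fieldCoord Γ c) z u) w.1 =
          fderiv ℝ (β c) z (horizontalProjector (fieldCoord Γ c) z w) u.1 := by
  have hev : ∀ c, ∀ z ∈ chartDomain c, ∀ᶠ p in 𝓝 z, formCoord θ c p =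
      (β c p).comp (ContinuousLinearMap.fst ℝ (Coord n) (Coord n)) := fun c z hz => by
    filter_upwards [(isOpen_chartDomain c).mem_nhds hz] with p hp using hθ c p hp
  have hd : ∀ c, ∀ z ∈ chartDomain c, DifferentiableAt ℝ (β c) z :=
    fun c z hz => differentiableAt_of_contDiffOn_chartDomain (hβ c) hz
  have hlie : ∀ c, ∀ z ∈ chartDomain c,
      (lieDerivForm liouvilleCoord (formCoord θ c) z = 0 ↔ vertDeriv (β c) z z.2 = 0) := by
    intro c z hz
    rw [lieDerivForm_liouvilleCoord_semiBasic (hev c z hz) (hd c z hz)]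
    constructor
    · intro h
      exact ContinuousLinearMap.ext fun w =>
        congrArg (fun L : (Coord n × Coord n) →L[ℝ] ℝ => L (w, 0)) h
    · intro h
      rw [h]
      rfl
  constructor
  · rintro ⟨h1, h2, h3⟩ c z hz
    refine ⟨(hlie c z hz).1 (h1 c z hz), fun u w => ?_, fun u w => ?_⟩
    · have := h2 c z hz (u, 0) (w, 0)
      rwa [dAlong_tangentStructure_semiBasic (hev c z hz) (hd c z hz), sub_eq_zero] at this
    · have := h3 c z hz u w
      rwa [dAlong_horizontalProjector_semiBasic (hev c z hz) (hd c z hz), sub_eq_zero] at this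
  · refine fun h => ⟨fun c z hz => (hlie c z hz).2 (h c z hz).1, fun c z hz u w => ?_,
      fun c z hz u w => ?_⟩
    · rw [dAlong_tangentStructure_semiBasic (hev c z hz) (hd c z hz), sub_eq_zero]
      exact (h c z hz).2.1 _ _
    · rw [dAlong_horizontalProjector_semiBasic (hev c z hz) (hd c z hz), sub_eq_zero]
      exact (h c z hz).2.2 _ _

theorem formRank_dForm_iff_quasiRegular (hn : 1 ≤ n) (hs : IsSmoothForm θ) (hb : IsSemiBasic θ)
    (hΓθ : DifferentialConditions Γ θ) (hz : z ∈ chartDomain c) :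
    formRank (dForm (formCoord θ c) z) = 2 * n - 2 ↔ QuasiRegular (multiplier θ c z) z.2 := by
  obtain ⟨hL, hJ, hH⟩ := (differentialConditions_iff hs.contDiffOn_semiBasicCoord
    (fun c z hz => hb.formCoord_eq hz)).1 hΓθ c z hz
  have hd := differentiableAt_of_contDiffOn_chartDomain (hs.contDiffOn_semiBasicCoord c) hz
  have hev : ∀ᶠ p in 𝓝 z, formCoord θ c p =
      (semiBasicCoord θ c p).comp (ContinuousLinearMap.fst ℝ (Coord n) (Coord n)) := by
    filter_upwards [(isOpen_chartDomain c).mem_nhds hz] with p hp using hb.formCoord_eq hp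
  have hrank := finrank_range_add_two_mul_finrank_ker (dForm_semiBasic hev hd) hJ
    (N := vertDeriv (sprayCoeff (fieldCoord Γ c)) z) (fun u w => hH (u, 0) (w, 0))
  rw [multiplier_eq, quasiRegular_iff_finrank_ker hJ (mem_chartDomain.1 hz).2 hL, formRank]
  rw [finrank_euclideanSpace_fin] at hrank
  have hker : Module.finrank ℝ (LinearMap.ker ((fderiv ℝ (semiBasicCoord θ c) z).comp
      (ContinuousLinearMap.inr ℝ (Coord n) (Coord n)) : Coord n →ₗ[ℝ] Coord n →L[ℝ] ℝ)) =
      Module.finrank ℝ (LinearMap.ker (vertDeriv (semiBasicCoord θ c) z :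
        Coord n →ₗ[ℝ] Coord n →L[ℝ] ℝ)) := rfl
  rw [hker] at hrank
  -- `1 ≤ n` keeps the subtraction in `2 * n - 2` from truncating
  omega

/-- The rank of `dθ` is `2n - 2` exactly where the multiplier is quasi-regular. -/
theorem hasRankAt_iff_multiplierQuasiRegularAt (hn : 1 ≤ n) (hs : IsSmoothForm θ)
    (hb : IsSemiBasic θ) (hΓθ : DifferentialConditions Γ θ) {v : TangentBundle (𝓡 n) M}
    (hv : v ∈ slit n M) : HasRankAt θ v (2 * n - 2) ↔ MultiplierQuasiRegularAt θ v :=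
  forall_congr' fun _ => forall_congr' fun hc =>
    formRank_dForm_iff_quasiRegular hn hs hb hΓθ (tangentChart_mem_chartDomain hc hv)

end Conditions

/-! ### From a pseudo-Finsler function to a form -/

section ToForm

variable {F : TangentBundle (𝓡 n) M → ℝ} {c : M} {z : Coord n × Coord n}

theorem IsPseudoFinsler.formCoord_eq (hF : IsPseudoFinsler F) (hz : z ∈ chartDomain c) :
    formCoord (fiberDifferential F) c z =
      (vertDeriv (funCoord F c) z).comp (ContinuousLinearMap.fst ℝ (Coord n) (Coord n)) :=
  formCoord_fiberDifferential hz.1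
    (differentiableAt_of_contDiffOn_chartDomain (hF.contDiffOn c) hz)

theorem IsPseudoFinsler.isSmoothForm (hF : IsPseudoFinsler F) :
    IsSmoothForm (fiberDifferential F) := fun c =>
  ((contDiffOn_vertDeriv (isOpen_chartDomain c) (hF.contDiffOn c)).clm_comp contDiffOn_const).congr
    fun _ hz => hF.formCoord_eq hz

theorem IsPseudoFinsler.multiplier_eq (hF : IsPseudoFinsler F) (hz : z ∈ chartDomain c) :
    multiplier (fiberDifferential F) c z = hessian F c z := by
  have h : (fun p => (formCoord (fiberDifferential F) c p).comp
      (ContinuousLinearMap.inl ℝ (Coord n) (Coord n))) =ᶠ[𝓝 z] vertDeriv (funCoord F c) := by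
    filter_upwards [(isOpen_chartDomain c).mem_nhds hz] with p hp
    rw [hF.formCoord_eq hp]
    rfl
  rw [multiplier, hessian, vertDeriv, h.fderiv_eq]
  rfl

theorem IsPseudoFinsler.differentialConditions (hF : IsPseudoFinsler F) {Γ : Field n M}
    (hΓ : Γ ∈ geodesicClass F) : DifferentialConditions Γ (fiberDifferential F) := by
  have ho := fun c : M => isOpen_chartDomain (n := n) c
  refine (differentialConditions_iff (fun c => contDiffOn_vertDeriv (ho c) (hF.contDiffOn c))
    fun c z hz => hF.formCoord_eq hz).2 fun c z hz => ⟨hF.hessian_self hz,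
      vertDeriv_vertDeriv_symm (ho c) (hF.contDiffOn c) hz,
      fderiv_vertDeriv_horizontalProjector_symm (ho c) (hF.contDiffOn c)
        (hΓ.1.contDiffOn_fieldCoord c) (fun p hp => hΓ.1.fieldCoord_fst hp)
        (((mem_geodesicClass_iff hF.contDiffOn).1 hΓ).2 c) hz⟩

end ToForm

/-! ### From a form to a pseudo-Finsler function -/

section ToFunction

variable {Γ : Field n M} {θ : OneForm n M} {c : M} {z : Coord n × Coord n}

/-- A spray is horizontal, `Γ = yⁱ H_i`, by the homogeneity of its coefficients. -/
theorem IsSpray.horizontalProjector_self (hΓ : IsSpray Γ) (hz : z ∈ chartDomain c) :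
    horizontalProjector (fieldCoord Γ c) z (z.2, 0) = fieldCoord Γ c z := by
  have hd : DifferentiableAt ℝ (fun p => (fieldCoord Γ c p).2) z :=
    differentiableAt_of_contDiffOn_chartDomain (hΓ.contDiffOn_fieldCoord c).snd hz
  have h : fderiv ℝ (sprayCoeff (fieldCoord Γ c)) z =
      (-(1 / 2 : ℝ)) • fderiv ℝ (fun p => (fieldCoord Γ c p).2) z :=
    (hd.hasFDerivAt.fun_const_smul (-(1 / 2 : ℝ))).fderiv
  ext1
  · exact (hΓ.fieldCoord_fst hz).symm
  · simp only [horizontalProjector, vertDeriv, h, ContinuousLinearMap.comp_apply,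
      ContinuousLinearMap.prod_apply, neg_apply, smul_apply, ContinuousLinearMap.inr_apply,
      ContinuousLinearMap.coe_fst']
    rw [hΓ.euler hz, smul_smul]
    norm_num

theorem funCoord_eq_contraction (hΓ : IsSpray Γ) (hb : IsSemiBasic θ) (hz : z ∈ chartDomain c) :
    funCoord (fun v => θ v (Γ v)) c z = semiBasicCoord θ c z z.2 := by
  rw [funCoord_contraction θ Γ hz.1, hb.formCoord_eq hz, ContinuousLinearMap.comp_apply,
    ContinuousLinearMap.coe_fst', hΓ.fieldCoord_fst hz]

/-- The function `F = θ(Γ) = θ_i yⁱ` attached to a form `θ` satisfying the differential conditions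
has `∂F/∂yⁱ = θ_i`, so it is a pseudo-Finsler function whose Hessian is the multiplier of `θ`; the
condition `d_H θ = 0` contracted with `Γ` says that `Γ` satisfies its Euler-Lagrange equations. -/
theorem isPseudoFinsler_contraction (hΓ : IsSpray Γ) (hs : IsSmoothForm θ) (hb : IsSemiBasic θ)
    (hΓθ : DifferentialConditions Γ θ)
    (hq : ∀ v ∈ slit n M, MultiplierQuasiRegularAt θ v) :
    IsPseudoFinsler (fun v => θ v (Γ v)) ∧ Γ ∈ geodesicClass (fun v => θ v (Γ v)) := by
  set F : TangentBundle (𝓡 n) M → ℝ := fun v => θ v (Γ v)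
  have hcond := (differentialConditions_iff hs.contDiffOn_semiBasicCoord
    (fun c z hz => hb.formCoord_eq hz)).1 hΓθ
  have hsm := hs.contDiffOn_semiBasicCoord
  have hf : ∀ c, ContDiffOn ℝ ∞ (funCoord F c) (chartDomain c) := fun c =>
    ((hsm c).clm_apply contDiffOn_snd).congr fun z hz => funCoord_eq_contraction hΓ hb hz
  have hev : ∀ c : M, ∀ z ∈ chartDomain c, funCoord F c =ᶠ[𝓝 z]
      fun p => semiBasicCoord θ c p p.2 := fun c z hz => by
    filter_upwards [(isOpen_chartDomain c).mem_nhds hz] with p hp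
      using funCoord_eq_contraction hΓ hb hp
  have hvert : ∀ c : M, ∀ z ∈ chartDomain c,
      vertDeriv (funCoord F c) z = semiBasicCoord θ c z := fun c z hz => by
    rw [vertDeriv, (hev c z hz).fderiv_eq]
    exact vertDeriv_contraction (differentiableAt_of_contDiffOn_chartDomain (hsm c) hz)
      (hcond c z hz).2.1 (hcond c z hz).1
  have hvert' : ∀ c : M, ∀ z ∈ chartDomain c,
      vertDeriv (funCoord F c) =ᶠ[𝓝 z] semiBasicCoord θ c := fun c z hz => by
    filter_upwards [(isOpen_chartDomain c).mem_nhds hz] with p hp using hvert c p hp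
  refine ⟨⟨contMDiffOn_slit_iff.2 hf, homogeneous_iff_funCoord.2 fun c z hz a ha => ?_,
    fun c z hz => ?_⟩, (mem_geodesicClass_iff hf).2 ⟨hΓ, fun c z hz => ?_⟩⟩
  · have h := apply_smul_of_euler (g := funCoord F c) (x := z.1) (y := z.2) 1
      (fun b hb => differentiableAt_of_contDiffOn_chartDomain (hf c) (smul_mem_chartDomain hz hb))
      (fun b hb' => by
        have hzb := smul_mem_chartDomain hz hb'
        rw [hvert c _ hzb, funCoord_eq_contraction hΓ hb hzb, Nat.cast_one, one_smul]) ha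
    simpa using h
  · have h := hq _ hz.2 c ((tangentChart c).map_target hz.1)
    rw [(tangentChart c).right_inv hz.1] at h
    rwa [hessian, vertDeriv, (hvert' c z hz).fderiv_eq]
  · have h := eulerLagrangeAt_contraction (isOpen_chartDomain c)
      ((hsm c).differentiableOn (by simp)) (fun p hp => (hcond c p hp).2.1)
      (fun p hp => (hcond c p hp).1) (fun p hp => (hcond c p hp).2.2)
      (fun p hp => hΓ.horizontalProjector_self hp) hz
    have hv : vertDeriv (funCoord F c) =ᶠ[𝓝 z]
        vertDeriv (fun p => semiBasicCoord θ c p p.2) := by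
      filter_upwards [(hev c z hz).eventuallyEq_nhds] with p hp
      rw [vertDeriv, vertDeriv, hp.fderiv_eq]
    rw [EulerLagrangeAt] at h ⊢
    rw [hv.fderiv_eq, h, baseDeriv, baseDeriv, (hev c z hz).fderiv_eq]

end ToFunction

end Geometry

end SprayGeometry

end

theorem mainTheorem3 (n : ℕ) (hn : 3 ≤ n) (M : Type*) [TopologicalSpace M] [T2Space M]
    [ParacompactSpace M] [ChartedSpace (SprayGeometry.Coord n) M] [IsManifold (𝓡 n) ∞ M]
    (Γ : SprayGeometry.Field n M) (hΓ : SprayGeometry.IsSpray Γ) :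
    ((∃ F : TangentBundle (𝓡 n) M → ℝ, SprayGeometry.IsPseudoFinsler F ∧
        SprayGeometry.geodesicClass F = SprayGeometry.projectiveClass Γ) ↔
      ∃ θ : SprayGeometry.OneForm n M, SprayGeometry.IsSmoothForm θ ∧
        SprayGeometry.IsSemiBasic θ ∧ SprayGeometry.DifferentialConditions Γ θ ∧
        ∀ v ∈ SprayGeometry.slit n M, SprayGeometry.HasRankAt θ v (2 * n - 2)) ∧
    ∀ θ : SprayGeometry.OneForm n M, SprayGeometry.IsSmoothForm θ →
      SprayGeometry.IsSemiBasic θ → SprayGeometry.DifferentialConditions Γ θ →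
      ∀ v ∈ SprayGeometry.slit n M,
        (SprayGeometry.HasRankAt θ v (2 * n - 2) ↔ SprayGeometry.MultiplierQuasiRegularAt θ v) := by
  have hn1 : 1 ≤ n := by omega
  refine ⟨⟨?_, ?_⟩, fun θ hs hb hc v hv =>
    SprayGeometry.hasRankAt_iff_multiplierQuasiRegularAt hn1 hs hb hc hv⟩
  · rintro ⟨F, hF, hclass⟩
    have hmem : Γ ∈ SprayGeometry.geodesicClass F := by
      rw [hclass]
      exact ⟨hΓ, SprayGeometry.geodesicsReparametrize_refl Γ,
        SprayGeometry.geodesicsReparametrize_refl Γ⟩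
    have hb := SprayGeometry.isSemiBasic_fiberDifferential F
    have hc := hF.differentialConditions hmem
    refine ⟨SprayGeometry.fiberDifferential F, hF.isSmoothForm, hb, hc, fun v hv => ?_⟩
    rw [SprayGeometry.hasRankAt_iff_multiplierQuasiRegularAt hn1 hF.isSmoothForm hb hc hv]
    intro c hcv
    have hz := SprayGeometry.tangentChart_mem_chartDomain hcv hv
    rw [hF.multiplier_eq hz]
    exact hF.quasiRegular c _ hz
  · rintro ⟨θ, hs, hb, hc, hrank⟩
    obtain ⟨hF, hmem⟩ := SprayGeometry.isPseudoFinsler_contraction hΓ hs hb hc fun v hv =>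
      (SprayGeometry.hasRankAt_iff_multiplierQuasiRegularAt hn1 hs hb hc hv).1 (hrank v hv)
    exact ⟨_, hF, hF.geodesicClass_eq_projectiveClass hmem⟩
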